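/- **Lemma.** For every $\varepsilon>0$ there is a constant $c>0$ such that for every $p>0$ there is a constant $C>0$ for which the following holds. Let $M\ge 1$ be an integer, let $d$ be a real number with $2\sqrt M\le d\le M$, and let $Q_1,Q_2\subset\mathbb R^2$ be two squares of area $M$ each (of arbitrary orientation) whose centers are at Euclidean distance $d$. Let $X_1,\dots,X_M,Y_1,\dots,Y_M$ be independent random points (nodes), with each $X_j$ uniformly distributed in $Q_1$ and each $Y_k$ uniformly distributed in $Q_2$, and let $\widehat H$ be the $M\times M$ line-of-sight channel matrix between the two clusters of nodes, with entries $$\widehat h_{jk}=\frac{e^{2\pi i\, r_{jk}}}{r_{jk}},\qquad r_{jk}=|X_j-Y_k|,\qquad 1\le j,k\le M .$$ Then, with $\|\cdot\|$ denoting the spectral norm (largest singular value), $$\mathbb P\left(\|\widehat H\|^2\le c\,\frac{M^{1+\varepsilon}}{d}\right)\ \ge\ 1-\frac{C}{M^{p}} .$$ In particular, the bound $\|\widehat H\|^2\le c\,M^{1+\varepsilon}/d$ holds with high probability as $M\to\infty$, uniformly in $d$ and in the position and orientation of the two squares. -/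

import Mathlib

open MeasureTheory ProbabilityTheory

noncomputable section

/-- The Euclidean plane. -/
abbrev Plane : Type := EuclideanSpace ℝ (Fin 2)

/-- The closed square with center `o` and side length `s` whose sides are parallel to the
orthonormal directions `(cos θ, sin θ)` and `(-sin θ, cos θ)`. -/
def tiltedSquare (o : Plane) (θ s : ℝ) : Set Plane :=
  {x | |Real.cos θ * (x 0 - o 0) + Real.sin θ * (x 1 - o 1)| ≤ s / 2 ∧
       |-Real.sin θ * (x 0 - o 0) + Real.cos θ * (x 1 - o 1)| ≤ s / 2}

/-- The line-of-sight channel matrix (carrier wavelength and Friis constant normalised to `1`)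
between the transmit nodes `y k` and the receive nodes `x j`: its `(j, k)` entry is
`exp (2 π i r) / r`, where `r` is the distance between `x j` and `y k`. -/
def losMatrix {M : ℕ} (x y : Fin M → Plane) : Matrix (Fin M) (Fin M) ℂ :=
  Matrix.of fun j k =>
    Complex.exp (2 * Real.pi * Complex.I * (dist (x j) (y k) : ℂ)) / (dist (x j) (y k) : ℂ)

/-- The spectral norm (largest singular value) of a complex square matrix: its operator norm
for the Euclidean norm on `ℂ ^ M`. -/
def spectralNormOf {M : ℕ} (A : Matrix (Fin M) (Fin M) ℂ) : ℝ :=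
  ‖Matrix.toEuclideanCLM (n := Fin M) (𝕜 := ℂ) A‖

/-- `X` and `Y` are the random positions of the nodes of two square clusters of `M` nodes each:
all `2 M` positions are independent, those of the first cluster are uniform in the square of
area `M` with center `o₁` and tilt `θ₁`, those of the second one are uniform in the square of
area `M` with center `o₂` and tilt `θ₂`. -/
structure IsUniformClusterPair {Ω : Type*} [MeasurableSpace Ω] (P : Measure Ω) (M : ℕ)
    (o₁ o₂ : Plane) (θ₁ θ₂ : ℝ) (X Y : Fin M → Ω → Plane) : Prop where
  measurable_fst : ∀ j, Measurable (X j)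
  measurable_snd : ∀ k, Measurable (Y k)
  indep : iIndepFun (Sum.elim X Y) P
  uniform_fst : ∀ j, pdf.IsUniform (X j) (tiltedSquare o₁ θ₁ (Real.sqrt M)) P volume
  uniform_snd : ∀ k, pdf.IsUniform (Y k) (tiltedSquare o₂ θ₂ (Real.sqrt M)) P volume

end

/-!
The gain `exp (2πir) / r` and its partial derivatives in the position of the receiver are waves
whose amplitudes are symbols of order zero in the distance `D` along the axis joining the clusters.
Two such waves sent from transversal positions `t, t'` have relative phase `2π (r - r')`, whose
transversal derivative is `≍ |t - t'| / d`. By the first derivative test their correlation over a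
transversal segment of length `O(d)` is `O(1 / (d (1 + |t - t'|)))`, and Schur's test turns this
into an energy bound with a mere logarithmic loss for the field of the sources in one unit slab.

Sobolev embedding in both variables bounds the sum over the nodes by the energy, at the cost of the
largest number of nodes in a unit cell, which is at most `M ^ (ε / 4)` up to rounding with high
probability. Summing over the `O(√M)` slabs on either side by Cauchy-Schwarz gives the bound
`M ^ (1 + ε) / d`.
-/

open scoped ComplexConjugate

noncomputable section

section PlanarPolar

/-- The length of the planar vector `(D, u)`: the distance between two nodes whose coordinates
differ by `D` along the line of sight and by `u` across it. -/
def planarRadius (D u : ℝ) : ℝ := √(D ^ 2 + u ^ 2)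

/-- The cosine of the angle between the planar vector `(D, u)` and the first axis. -/
def planarCos (D u : ℝ) : ℝ := D / planarRadius D u

/-- The sine of the angle between the planar vector `(D, u)` and the first axis. -/
def planarSin (D u : ℝ) : ℝ := u / planarRadius D u

/-- The angular speed `∂ sin / ∂u`, that is, the second transversal derivative of the radius. -/
def planarCurvature (D u : ℝ) : ℝ := planarCos D u ^ 2 / planarRadius D u

variable {D D' u δ : ℝ}

lemma planarRadius_sq (D u : ℝ) : planarRadius D u ^ 2 = D ^ 2 + u ^ 2 :=
  Real.sq_sqrt (by positivity)

lemma planarRadius_pos (hD : 0 < D) (u : ℝ) : 0 < planarRadius D u :=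
  Real.sqrt_pos.2 (by positivity)

lemma le_planarRadius (D u : ℝ) : D ≤ planarRadius D u :=
  Real.le_sqrt_of_sq_le (le_add_of_nonneg_right (sq_nonneg u))

lemma abs_le_planarRadius (D u : ℝ) : |u| ≤ planarRadius D u :=
  Real.le_sqrt_of_sq_le (by rw [sq_abs]; exact le_add_of_nonneg_left (sq_nonneg D))

lemma planarCos_pos (hD : 0 < D) (u : ℝ) : 0 < planarCos D u :=
  div_pos hD (planarRadius_pos hD u)

lemma planarCos_le_one (hD : 0 < D) (u : ℝ) : planarCos D u ≤ 1 :=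
  (div_le_one (planarRadius_pos hD u)).2 (le_planarRadius D u)

lemma abs_planarSin_le_one (hD : 0 < D) (u : ℝ) : |planarSin D u| ≤ 1 := by
  rw [planarSin, abs_div, abs_of_pos (planarRadius_pos hD u)]
  exact (div_le_one (planarRadius_pos hD u)).2 (abs_le_planarRadius D u)

lemma planarCos_sq_add_planarSin_sq (hD : 0 < D) (u : ℝ) :
    planarCos D u ^ 2 + planarSin D u ^ 2 = 1 := by
  have hr := planarRadius_pos hD u
  rw [planarCos, planarSin, div_pow, div_pow, ← add_div, ← planarRadius_sq,
    div_self (by positivity)]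

lemma hasDerivAt_planarRadius_snd (hD : 0 < D) (u : ℝ) :
    HasDerivAt (planarRadius D) (planarSin D u) u := by
  have hsq : HasDerivAt (fun u => D ^ 2 + u ^ 2) (2 * u) u := by
    simpa using ((hasDerivAt_id u).pow 2).const_add (D ^ 2)
  refine (hsq.sqrt (by positivity)).congr_deriv ?_
  rw [planarSin, planarRadius]
  field_simp

lemma hasDerivAt_planarRadius_fst (hD : 0 < D) (u : ℝ) :
    HasDerivAt (planarRadius · u) (planarCos D u) D := by
  have hsq : HasDerivAt (fun D => D ^ 2 + u ^ 2) (2 * D) D := by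
    simpa using ((hasDerivAt_id D).pow 2).add_const (u ^ 2)
  refine (hsq.sqrt (by positivity)).congr_deriv ?_
  rw [planarCos, planarRadius]
  field_simp

lemma hasDerivAt_planarCos_snd (hD : 0 < D) (u : ℝ) :
    HasDerivAt (planarCos D) (-(planarCos D u * planarSin D u / planarRadius D u)) u := by
  have hr := planarRadius_pos hD u
  refine ((hasDerivAt_const u D).div (hasDerivAt_planarRadius_snd hD u) hr.ne').congr_deriv ?_
  rw [planarCos]
  field_simp
  ring

lemma hasDerivAt_planarCos_fst (hD : 0 < D) (u : ℝ) :
    HasDerivAt (planarCos · u) (planarSin D u ^ 2 / planarRadius D u) D := by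
  have hr := planarRadius_pos hD u
  refine ((hasDerivAt_id D).div (hasDerivAt_planarRadius_fst hD u) hr.ne').congr_deriv ?_
  rw [eq_sub_of_add_eq' (planarCos_sq_add_planarSin_sq hD u), planarCos, id]
  field_simp

lemma hasDerivAt_planarSin_snd (hD : 0 < D) (u : ℝ) :
    HasDerivAt (planarSin D) (planarCurvature D u) u := by
  have hr := planarRadius_pos hD u
  refine ((hasDerivAt_id u).div (hasDerivAt_planarRadius_snd hD u) hr.ne').congr_deriv ?_
  rw [planarCurvature, eq_sub_of_add_eq (planarCos_sq_add_planarSin_sq hD u), planarSin, id]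
  field_simp

lemma hasDerivAt_planarSin_fst (hD : 0 < D) (u : ℝ) :
    HasDerivAt (planarSin · u) (-(planarSin D u * planarCos D u / planarRadius D u)) D := by
  have hr := planarRadius_pos hD u
  refine ((hasDerivAt_const D u).div (hasDerivAt_planarRadius_fst hD u) hr.ne').congr_deriv ?_
  rw [planarSin]
  field_simp
  ring

lemma contDiff_planarRadius (hD : 0 < D) {n : WithTop ℕ∞} : ContDiff ℝ n (planarRadius D) :=
  ContDiff.sqrt (by fun_prop) fun u => by positivity

lemma contDiff_planarCos (hD : 0 < D) {n : WithTop ℕ∞} : ContDiff ℝ n (planarCos D) :=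
  contDiff_const.div (contDiff_planarRadius hD) fun u => (planarRadius_pos hD u).ne'

lemma contDiff_planarSin (hD : 0 < D) {n : WithTop ℕ∞} : ContDiff ℝ n (planarSin D) :=
  contDiff_id.div (contDiff_planarRadius hD) fun u => (planarRadius_pos hD u).ne'

lemma continuous_planarCurvature (hD : 0 < D) : Continuous (planarCurvature D) :=
  ((contDiff_planarCos hD (n := 0)).continuous.pow 2).div
    (contDiff_planarRadius hD (n := 0)).continuous fun u => (planarRadius_pos hD u).ne'

lemma hasDerivAt_planarCurvature_snd (hD : 0 < D) (u : ℝ) :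
    HasDerivAt (planarCurvature D)
      (-(3 * planarCos D u ^ 2 * planarSin D u) / planarRadius D u ^ 2) u := by
  have hr := planarRadius_pos hD u
  refine (((hasDerivAt_planarCos_snd hD u).pow 2).div
    (hasDerivAt_planarRadius_snd hD u) hr.ne').congr_deriv ?_
  simp only [Pi.pow_apply]
  field_simp
  ring

lemma hasDerivAt_planarCurvature_fst (hD : 0 < D) (u : ℝ) :
    HasDerivAt (planarCurvature · u)
      ((2 * planarCos D u * planarSin D u ^ 2 - planarCos D u ^ 3) / planarRadius D u ^ 2) D := by
  have hr := planarRadius_pos hD u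
  refine (((hasDerivAt_planarCos_fst hD u).pow 2).div
    (hasDerivAt_planarRadius_fst hD u) hr.ne').congr_deriv ?_
  simp only [Pi.pow_apply]
  field_simp
  ring

lemma mul_abs_sub_le_abs_planarSin_sub {a u' : ℝ} (hD : 0 < D) (hu : |u| ≤ a) (hu' : |u'| ≤ a) :
    D ^ 2 / planarRadius D a ^ 3 * |u - u'| ≤ |planarSin D u - planarSin D u'| := by
  wlog h : u' ≤ u generalizing u u'
  · rw [abs_sub_comm u, abs_sub_comm (planarSin D u)]
    exact this hu' hu (le_of_not_ge h)
  have hderiv (v : ℝ) (hv : v ∈ interior (Set.Icc (-a) a)) :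
      D ^ 2 / planarRadius D a ^ 3 ≤ deriv (planarSin D) v := by
    have hr := planarRadius_pos hD v
    have hle : planarRadius D v ≤ planarRadius D a :=
      Real.sqrt_le_sqrt (add_le_add_right (sq_le_sq' (interior_subset hv).1
        (interior_subset hv).2) _)
    rw [(hasDerivAt_planarSin_snd hD v).deriv, planarCurvature, planarCos, div_pow, div_div,
      ← pow_succ]
    gcongr
  have hslope := (convex_Icc (-a) a).mul_sub_le_image_sub_of_le_deriv
    (contDiff_planarSin hD (n := 1)).continuous.continuousOn
    ((contDiff_planarSin hD).differentiable one_ne_zero).differentiableOn hderiv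
    u' (abs_le.1 hu') u (abs_le.1 hu) h
  rw [abs_of_nonneg (sub_nonneg.2 h)]
  exact hslope.trans (le_abs_self _)

lemma abs_sub_le_of_abs_hasDerivAt_le {f f' : ℝ → ℝ} {K : ℝ}
    (hf : ∀ x, δ ≤ x → HasDerivAt f (f' x) x) (hf' : ∀ x, δ ≤ x → |f' x| ≤ K)
    {x y : ℝ} (hx : δ ≤ x) (hy : δ ≤ y) : |f x - f y| ≤ K * |x - y| :=
  (convex_Ici δ).norm_image_sub_le_of_norm_hasDerivWithin_le
    (fun z hz => (hf z hz).hasDerivWithinAt) hf' hy hx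

lemma abs_planarSin_sub_le_fst (hδ : 0 < δ) (hD : δ ≤ D) (hD' : δ ≤ D') (u : ℝ) :
    |planarSin D u - planarSin D' u| ≤ δ⁻¹ * |D - D'| := by
  refine abs_sub_le_of_abs_hasDerivAt_le (f := (planarSin · u))
    (fun x hx => hasDerivAt_planarSin_fst (hδ.trans_le hx) u) (fun x hx => ?_) hD hD'
  have hx0 := hδ.trans_le hx
  rw [abs_neg, abs_div, abs_mul, abs_of_pos (planarCos_pos hx0 u),
    abs_of_pos (planarRadius_pos hx0 u), ← one_div]
  exact div_le_div₀ one_pos.le (mul_le_one₀ (abs_planarSin_le_one hx0 u)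
    (planarCos_pos hx0 u).le (planarCos_le_one hx0 u)) hδ (hx.trans (le_planarRadius x u))

lemma abs_planarCurvature_sub_le_snd (hD : 0 < D) (u u' : ℝ) :
    |planarCurvature D u - planarCurvature D u'| ≤ 3 / D ^ 2 * |u - u'| := by
  refine convex_univ.norm_image_sub_le_of_norm_hasDerivWithin_le
    (fun v _ => (hasDerivAt_planarCurvature_snd hD v).hasDerivWithinAt) (fun v _ => ?_)
    (Set.mem_univ u') (Set.mem_univ u)
  have hc := planarCos_pos hD v
  have hcs : planarCos D v ^ 2 * |planarSin D v| ≤ 1 :=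
    mul_le_one₀ (pow_le_one₀ hc.le (planarCos_le_one hD v)) (abs_nonneg _)
      (abs_planarSin_le_one hD v)
  rw [Real.norm_eq_abs, abs_div, abs_neg, abs_mul,
    abs_of_nonneg (by positivity : (0 : ℝ) ≤ 3 * _ ^ 2),
    abs_of_nonneg (sq_nonneg (planarRadius D v))]
  exact div_le_div₀ (by norm_num) (by linarith) (by positivity)
    (pow_le_pow_left₀ hD.le (le_planarRadius D v) 2)

lemma abs_planarCurvature_sub_le_fst (hδ : 0 < δ) (hD : δ ≤ D) (hD' : δ ≤ D') (u : ℝ) :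
    |planarCurvature D u - planarCurvature D' u| ≤ 3 / δ ^ 2 * |D - D'| := by
  refine abs_sub_le_of_abs_hasDerivAt_le (f := (planarCurvature · u))
    (fun x hx => hasDerivAt_planarCurvature_fst (hδ.trans_le hx) u) (fun x hx => ?_) hD hD'
  have hx0 := hδ.trans_le hx
  have hc := planarCos_pos hx0 u
  have hc1 := planarCos_le_one hx0 u
  have hnum : |2 * planarCos x u * planarSin x u ^ 2 - planarCos x u ^ 3| ≤ 3 := by
    have hsq := planarCos_sq_add_planarSin_sq hx0 u
    rw [abs_le]
    constructor <;> nlinarith [sq_nonneg (planarCos x u), sq_nonneg (planarSin x u), mul_pos hc hc]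
  rw [abs_div, abs_of_nonneg (sq_nonneg (planarRadius x u))]
  exact div_le_div₀ (by norm_num) hnum (by positivity)
    (pow_le_pow_left₀ hδ.le (hx.trans (le_planarRadius x u)) 2)

end PlanarPolar

section Symbols

/-- Symbols of order zero with constant `C`: families of amplitudes `A D` bounded by `C` uniformly
in `D ≥ 1`, whose derivative gains a factor `1 / D`. -/
structure IsSymbolWith (C : ℝ) (A : ℝ → ℝ → ℂ) : Prop where
  contDiff : ∀ D, 1 ≤ D → ContDiff ℝ 1 (A D)
  norm_le : ∀ D, 1 ≤ D → ∀ u, ‖A D u‖ ≤ C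
  norm_deriv_le : ∀ D, 1 ≤ D → ∀ u, ‖deriv (A D) u‖ ≤ C / D

namespace IsSymbolWith

variable {C C' : ℝ} {A A' : ℝ → ℝ → ℂ}

lemma nonneg (hA : IsSymbolWith C A) : 0 ≤ C :=
  (norm_nonneg _).trans (hA.norm_le 1 le_rfl 0)

lemma mono (hA : IsSymbolWith C A) (hC : C ≤ C') : IsSymbolWith C' A where
  contDiff := hA.contDiff
  norm_le D hD u := (hA.norm_le D hD u).trans hC
  norm_deriv_le D hD u :=
    (hA.norm_deriv_le D hD u).trans (div_le_div_of_nonneg_right hC (zero_le_one.trans hD))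

lemma differentiableAt (hA : IsSymbolWith C A) {D : ℝ} (hD : 1 ≤ D) (u : ℝ) :
    DifferentiableAt ℝ (A D) u :=
  (hA.contDiff D hD).differentiable one_ne_zero u

lemma sub (hA : IsSymbolWith C A) (hA' : IsSymbolWith C' A') : IsSymbolWith (C + C') (A - A') where
  contDiff D hD := (hA.contDiff D hD).sub (hA'.contDiff D hD)
  norm_le D hD u := norm_sub_le_of_le (hA.norm_le D hD u) (hA'.norm_le D hD u)
  norm_deriv_le D hD u := by
    rw [Pi.sub_apply, deriv_sub (hA.differentiableAt hD u) (hA'.differentiableAt hD u), add_div]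
    exact norm_sub_le_of_le (hA.norm_deriv_le D hD u) (hA'.norm_deriv_le D hD u)

lemma mul (hA : IsSymbolWith C A) (hA' : IsSymbolWith C' A') :
    IsSymbolWith (2 * (C * C')) (A * A') where
  contDiff D hD := (hA.contDiff D hD).mul (hA'.contDiff D hD)
  norm_le D hD u := by
    have hCC' := mul_nonneg hA.nonneg hA'.nonneg
    calc ‖A D u * A' D u‖ ≤ C * C' :=
          norm_mul_le_of_le (hA.norm_le D hD u) (hA'.norm_le D hD u)
      _ ≤ 2 * (C * C') := by linarith
  norm_deriv_le D hD u := by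
    rw [Pi.mul_apply, deriv_mul (hA.differentiableAt hD u) (hA'.differentiableAt hD u)]
    calc _ ≤ C / D * C' + C * (C' / D) := norm_add_le_of_le
          (norm_mul_le_of_le (hA.norm_deriv_le D hD u) (hA'.norm_le D hD u))
          (norm_mul_le_of_le (hA.norm_le D hD u) (hA'.norm_deriv_le D hD u))
      _ = 2 * (C * C') / D := by ring

lemma const (z : ℂ) : IsSymbolWith ‖z‖ fun _ _ => z where
  contDiff _ _ := contDiff_const
  norm_le _ _ _ := le_rfl
  norm_deriv_le D hD u := by
    rw [deriv_const, norm_zero]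
    exact div_nonneg (norm_nonneg z) (zero_le_one.trans hD)

lemma cos : IsSymbolWith 1 fun D u => (planarCos D u : ℂ) where
  contDiff D hD := Complex.ofRealCLM.contDiff.comp (contDiff_planarCos (one_pos.trans_le hD))
  norm_le D hD u := by
    have hD0 := one_pos.trans_le hD
    rw [Complex.norm_of_nonneg (planarCos_pos hD0 u).le]
    exact planarCos_le_one hD0 u
  norm_deriv_le D hD u := by
    have hD0 := one_pos.trans_le hD
    have hc := planarCos_pos hD0 u
    have hr := planarRadius_pos hD0 u
    rw [(hasDerivAt_planarCos_snd hD0 u).ofReal_comp.deriv, Complex.norm_real, norm_neg, norm_div,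
      norm_mul, Real.norm_of_nonneg hc.le, Real.norm_of_nonneg hr.le]
    exact div_le_div₀ zero_le_one (mul_le_one₀ (planarCos_le_one hD0 u) (norm_nonneg _)
      (abs_planarSin_le_one hD0 u)) hD0 (le_planarRadius D u)

lemma sin : IsSymbolWith 1 fun D u => (planarSin D u : ℂ) where
  contDiff D hD := Complex.ofRealCLM.contDiff.comp (contDiff_planarSin (one_pos.trans_le hD))
  norm_le D hD u := by
    rw [Complex.norm_real]
    exact abs_planarSin_le_one (one_pos.trans_le hD) u
  norm_deriv_le D hD u := by
    have hD0 := one_pos.trans_le hD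
    have hc := planarCos_pos hD0 u
    have hr := planarRadius_pos hD0 u
    rw [(hasDerivAt_planarSin_snd hD0 u).ofReal_comp.deriv, planarCurvature,
      Complex.norm_of_nonneg (by positivity)]
    exact div_le_div₀ zero_le_one (pow_le_one₀ hc.le (planarCos_le_one hD0 u)) hD0
      (le_planarRadius D u)

lemma inv_radius : IsSymbolWith 1 fun D u => (planarRadius D u : ℂ)⁻¹ where
  contDiff D hD := by
    have hD0 := one_pos.trans_le hD
    exact (Complex.ofRealCLM.contDiff.comp (contDiff_planarRadius hD0)).inv fun u =>
      Complex.ofReal_ne_zero.2 (planarRadius_pos hD0 u).ne'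
  norm_le D hD u := by
    rw [norm_inv, Complex.norm_of_nonneg (planarRadius_pos (one_pos.trans_le hD) u).le]
    exact inv_le_one_of_one_le₀ (hD.trans (le_planarRadius D u))
  norm_deriv_le D hD u := by
    have hD0 := one_pos.trans_le hD
    have hr := planarRadius_pos hD0 u
    rw [((hasDerivAt_planarRadius_snd hD0 u).ofReal_comp.fun_inv
      (Complex.ofReal_ne_zero.2 hr.ne')).deriv, norm_div, norm_neg, norm_pow, Complex.norm_real,
      Complex.norm_of_nonneg hr.le]
    refine div_le_div₀ zero_le_one (abs_planarSin_le_one hD0 u) hD0 ?_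
    nlinarith [le_planarRadius D u]

end IsSymbolWith

end Symbols

section Waves

/-- The wavenumber `2πi` of the line-of-sight channel. -/
abbrev losWavenumber : ℂ := 2 * Real.pi * Complex.I

/-- The line-of-sight channel gain at distance `r`. -/
def losGain (r : ℝ) : ℂ := Complex.exp (losWavenumber * r) / r

/-- The planar wave obtained by modulating the line-of-sight gain by the amplitude `A`. The gain
and its partial derivatives are all of this form. -/
def wave (A : ℝ → ℝ → ℂ) (D u : ℝ) : ℂ := losGain (planarRadius D u) * A D u

/-- The logarithmic derivative of the line-of-sight gain with respect to the distance. -/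
def radialAmp (D u : ℝ) : ℂ := losWavenumber - (planarRadius D u : ℂ)⁻¹

/-- The amplitude of the longitudinal derivative of the line-of-sight gain. -/
def longAmp (D u : ℝ) : ℂ := planarCos D u * radialAmp D u

/-- The amplitude of the transversal derivative of the line-of-sight gain. -/
def transAmp (D u : ℝ) : ℂ := planarSin D u * radialAmp D u

/-- The amplitude of the mixed second derivative of the line-of-sight gain. -/
def mixedAmp (D u : ℝ) : ℂ :=
  planarCos D u * planarSin D u * (losWavenumber * losWavenumber -
    (3 * losWavenumber * (planarRadius D u : ℂ)⁻¹ -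
      3 * (planarRadius D u : ℂ)⁻¹ * (planarRadius D u : ℂ)⁻¹))

/-- `C` is a common symbol constant for the amplitudes of the line-of-sight gain, of its partial
derivatives and of its mixed second derivative. -/
structure IsLosConstant (C : ℝ) : Prop where
  one : IsSymbolWith C 1
  trans : IsSymbolWith C transAmp
  long : IsSymbolWith C longAmp
  mixed : IsSymbolWith C mixedAmp

lemma IsLosConstant.pos {C : ℝ} (hC : IsLosConstant C) : 0 < C :=
  zero_lt_one.trans_le (by simpa using hC.one.norm_le 1 le_rfl 0)

open IsSymbolWith in
lemma exists_isLosConstant : ∃ C, IsLosConstant C := by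
  have hradial : IsSymbolWith _ radialAmp := (const losWavenumber).sub inv_radius
  have hlong : IsSymbolWith _ longAmp := cos.mul hradial
  have htrans : IsSymbolWith _ transAmp := sin.mul hradial
  have hmixed : IsSymbolWith _ mixedAmp := (cos.mul sin).mul
    (((const losWavenumber).mul (const losWavenumber)).sub
      (((const (3 * losWavenumber)).mul inv_radius).sub
        (((const 3).mul inv_radius).mul inv_radius)))
  exact ⟨max (max _ _) (max _ _),
    (const 1).mono ((le_max_left _ _).trans (le_max_left _ _)),
    htrans.mono ((le_max_right _ _).trans (le_max_left _ _)),
    hlong.mono ((le_max_left _ _).trans (le_max_right _ _)),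
    hmixed.mono ((le_max_right _ _).trans (le_max_right _ _))⟩

variable {A : ℝ → ℝ → ℂ} {D : ℝ}

lemma hasDerivAt_losGain {r : ℝ} (hr : r ≠ 0) :
    HasDerivAt losGain (losGain r * (losWavenumber - (r : ℂ)⁻¹)) r := by
  have hr' : (r : ℂ) ≠ 0 := Complex.ofReal_ne_zero.2 hr
  have hid := (hasDerivAt_id r).ofReal_comp
  refine ((hid.const_mul losWavenumber).cexp.div hid hr').congr_deriv ?_
  rw [losGain]
  simp only [id, Complex.ofReal_one]
  field_simp

lemma hasDerivAt_losGain_planarRadius_snd (hD : 0 < D) (u : ℝ) :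
    HasDerivAt (fun u => losGain (planarRadius D u))
      (losGain (planarRadius D u) * (planarSin D u * radialAmp D u)) u := by
  refine ((hasDerivAt_losGain (planarRadius_pos hD u).ne').scomp u
    (hasDerivAt_planarRadius_snd hD u)).congr_deriv ?_
  rw [Complex.real_smul, radialAmp]
  ring

lemma wave_one (D u : ℝ) : wave 1 D u = losGain (planarRadius D u) := mul_one _

lemma hasDerivAt_wave_one_snd (hD : 0 < D) (u : ℝ) :
    HasDerivAt (wave 1 D) (wave transAmp D u) u := by
  rw [funext (wave_one D)]
  exact hasDerivAt_losGain_planarRadius_snd hD u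

lemma hasDerivAt_wave_one_fst (hD : 0 < D) (u : ℝ) :
    HasDerivAt (wave 1 · u) (wave longAmp D u) D := by
  simp only [wave_one]
  refine ((hasDerivAt_losGain (planarRadius_pos hD u).ne').scomp D
    (hasDerivAt_planarRadius_fst hD u)).congr_deriv ?_
  rw [Complex.real_smul, wave, longAmp, radialAmp]
  ring

lemma hasDerivAt_wave_longAmp_snd (hD : 0 < D) (u : ℝ) :
    HasDerivAt (wave longAmp D) (wave mixedAmp D u) u := by
  have hr : (planarRadius D u : ℂ) ≠ 0 := Complex.ofReal_ne_zero.2 (planarRadius_pos hD u).ne'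
  have hradial := ((hasDerivAt_planarRadius_snd hD u).ofReal_comp.fun_inv hr).const_sub
    losWavenumber
  have hamp := (hasDerivAt_planarCos_snd hD u).ofReal_comp.mul hradial
  refine ((hasDerivAt_losGain_planarRadius_snd hD u).mul hamp).congr_deriv ?_
  simp only [wave, mixedAmp, radialAmp, Pi.mul_apply]
  push_cast
  field_simp
  ring

lemma contDiff_wave {C : ℝ} (hA : IsSymbolWith C A) (hD : 1 ≤ D) : ContDiff ℝ 1 (wave A D) := by
  have hD0 := one_pos.trans_le hD
  have hr : ContDiff ℝ 1 fun u => (planarRadius D u : ℂ) :=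
    Complex.ofRealCLM.contDiff.comp (contDiff_planarRadius hD0)
  have hgain : ContDiff ℝ 1 fun u => losGain (planarRadius D u) := by
    simp only [losGain, div_eq_mul_inv]
    exact (contDiff_const.mul hr).cexp.mul
      (hr.inv fun u => Complex.ofReal_ne_zero.2 (planarRadius_pos hD0 u).ne')
  exact hgain.mul (hA.contDiff D hD)

end Waves

section FirstDerivativeTest

open Set intervalIntegral

variable {α β : ℝ} {φ φ' φ'' : ℝ → ℝ}

lemma norm_integral_exp_mul_I_mul_deriv_le {w w' : ℝ → ℂ} {W W' : ℝ} (hαβ : α ≤ β)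
    (hφ : ∀ s ∈ Icc α β, HasDerivAt φ (φ' s) s) (hφ' : ContinuousOn φ' (Icc α β))
    (hw : ∀ s ∈ Icc α β, HasDerivAt w (w' s) s) (hw' : ContinuousOn w' (Icc α β))
    (hW : ∀ s ∈ Icc α β, ‖w s‖ ≤ W) (hW' : ∀ s ∈ Icc α β, ‖w' s‖ ≤ W') :
    ‖∫ s in α..β, w s * (Complex.exp (φ s * Complex.I) * (φ' s * Complex.I))‖ ≤
      2 * W + W' * (β - α) := by
  set E : ℝ → ℂ := fun s => Complex.exp (φ s * Complex.I)
  have hE (s : ℝ) : ‖E s‖ = 1 := Complex.norm_exp_ofReal_mul_I (φ s)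
  have hE' (s : ℝ) (hs : s ∈ Icc α β) : HasDerivAt E (E s * (φ' s * Complex.I)) s :=
    ((hφ s hs).ofReal_comp.mul_const Complex.I).cexp
  have hE'_cont : ContinuousOn (fun s => E s * (φ' s * Complex.I)) (Icc α β) :=
    ContinuousOn.mul (fun s hs => (hE' s hs).continuousAt.continuousWithinAt)
      ((Complex.continuous_ofReal.comp_continuousOn hφ').mul continuousOn_const)
  have hparts := integral_mul_deriv_eq_deriv_mul (fun s hs => hw s (uIcc_of_le hαβ ▸ hs))
    (fun s hs => hE' s (uIcc_of_le hαβ ▸ hs)) (hw'.intervalIntegrable_of_Icc hαβ)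
    (hE'_cont.intervalIntegrable_of_Icc hαβ)
  have hint : ‖∫ s in α..β, w' s * E s‖ ≤ W' * (β - α) := by
    rw [← abs_of_nonneg (sub_nonneg.2 hαβ)]
    refine norm_integral_le_of_norm_le_const fun s hs => ?_
    rw [norm_mul, hE, mul_one]
    exact hW' s (Ioc_subset_Icc_self (uIoc_of_le hαβ ▸ hs))
  have hboundary {s : ℝ} (hs : s ∈ Icc α β) : ‖w s * E s‖ ≤ W := by
    rw [norm_mul, hE, mul_one]
    exact hW s hs
  rw [hparts, two_mul]
  exact norm_sub_le_of_le (norm_sub_le_of_le (hboundary (right_mem_Icc.2 hαβ))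
    (hboundary (left_mem_Icc.2 hαβ))) hint

lemma norm_quotient_rule_le {a a' g g' : ℂ} {l κ b₀ b₁ : ℝ} (hl : 0 < l) (hl_le : l ≤ ‖g‖)
    (hb₀ : ‖a‖ ≤ b₀) (hb₁ : ‖a'‖ ≤ b₁) (hκ : ‖g'‖ ≤ κ) :
    ‖(a' * g - a * g') / g ^ 2‖ ≤ b₁ / l + b₀ * κ / l ^ 2 := by
  have hg : g ≠ 0 := norm_pos_iff.1 (hl.trans_le hl_le)
  have hsplit : (a' * g - a * g') / g ^ 2 = a' / g - a * g' / g ^ 2 := by field_simp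
  have hb₀_nonneg : 0 ≤ b₀ := (norm_nonneg a).trans hb₀
  rw [hsplit]
  refine norm_sub_le_of_le ?_ ?_
  · rw [norm_div]
    exact div_le_div₀ ((norm_nonneg a').trans hb₁) hb₁ hl hl_le
  · rw [norm_div, norm_mul, norm_pow]
    exact div_le_div₀ (mul_nonneg hb₀_nonneg ((norm_nonneg g').trans hκ))
      (mul_le_mul hb₀ hκ (norm_nonneg g') hb₀_nonneg) (by positivity)
      (pow_le_pow_left₀ hl.le hl_le 2)

lemma norm_integral_exp_mul_I_le {B B' : ℝ → ℂ} {l κ b₀ b₁ : ℝ} (hαβ : α ≤ β) (hl : 0 < l)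
    (hφ : ∀ s ∈ Icc α β, HasDerivAt φ (φ' s) s) (hφ' : ∀ s ∈ Icc α β, HasDerivAt φ' (φ'' s) s)
    (hφ'' : ContinuousOn φ'' (Icc α β)) (hB : ∀ s ∈ Icc α β, HasDerivAt B (B' s) s)
    (hB' : ContinuousOn B' (Icc α β)) (hl_le : ∀ s ∈ Icc α β, l ≤ |φ' s|)
    (hκ : ∀ s ∈ Icc α β, |φ'' s| ≤ κ) (hb₀ : ∀ s ∈ Icc α β, ‖B s‖ ≤ b₀)
    (hb₁ : ∀ s ∈ Icc α β, ‖B' s‖ ≤ b₁) :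
    ‖∫ s in α..β, Complex.exp (φ s * Complex.I) * B s‖ ≤
      2 * (b₀ / l) + (b₁ / l + b₀ * κ / l ^ 2) * (β - α) := by
  have hB_cont : ContinuousOn B (Icc α β) := fun s hs => (hB s hs).continuousAt.continuousWithinAt
  have hφ'_cont : ContinuousOn φ' (Icc α β) :=
    fun s hs => (hφ' s hs).continuousAt.continuousWithinAt
  set g : ℝ → ℂ := fun s => φ' s * Complex.I
  have hg_norm (s : ℝ) : ‖g s‖ = |φ' s| := by simp [g]
  have hg_ne (s : ℝ) (hs : s ∈ Icc α β) : g s ≠ 0 :=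
    norm_pos_iff.1 ((hl.trans_le (hl_le s hs)).trans_eq (hg_norm s).symm)
  have hg_cont : ContinuousOn g (Icc α β) :=
    (Complex.continuous_ofReal.comp_continuousOn hφ'_cont).mul continuousOn_const
  have hg'_cont : ContinuousOn (fun s => φ'' s * Complex.I) (Icc α β) :=
    (Complex.continuous_ofReal.comp_continuousOn hφ'').mul continuousOn_const
  have hquot (s : ℝ) (hs : s ∈ Icc α β) := (hB s hs).div
    ((hφ' s hs).ofReal_comp.mul_const Complex.I) (hg_ne s hs)
  have hb₀_nonneg : 0 ≤ b₀ := (norm_nonneg _).trans (hb₀ α (left_mem_Icc.2 hαβ))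
  have hquot_norm (s : ℝ) (hs : s ∈ Icc α β) : ‖B s / g s‖ ≤ b₀ / l := by
    rw [norm_div, hg_norm]
    exact div_le_div₀ hb₀_nonneg (hb₀ s hs) hl (hl_le s hs)
  have hquot'_norm (s : ℝ) (hs : s ∈ Icc α β) :
      ‖(B' s * g s - B s * (φ'' s * Complex.I)) / g s ^ 2‖ ≤ b₁ / l + b₀ * κ / l ^ 2 := by
    refine norm_quotient_rule_le hl ((hl_le s hs).trans_eq (hg_norm s).symm) (hb₀ s hs)
      (hb₁ s hs) ?_
    simpa using hκ s hs
  refine le_of_eq_of_le (congrArg norm (integral_congr fun s hs => ?_))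
    (norm_integral_exp_mul_I_mul_deriv_le hαβ hφ hφ'_cont hquot
      (((hB'.mul hg_cont).sub (hB_cont.mul hg'_cont)).div (hg_cont.pow 2)
        fun s hs => pow_ne_zero 2 (hg_ne s hs)) hquot_norm hquot'_norm)
  have hne : g s ≠ 0 := hg_ne s (uIcc_of_le hαβ ▸ hs)
  exact (show _ = B s / g s * (Complex.exp (φ s * Complex.I) * g s) by field_simp [hne])

end FirstDerivativeTest

section Correlation

variable {A : ℝ → ℝ → ℂ} {C D D' t t' u u' δ Λ α β : ℝ}

/-- The slowly varying factor `A / r` of `wave A`, which remains once the oscillation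
`exp (2πi r)` is removed. -/
def waveEnvelope (A : ℝ → ℝ → ℂ) (D u : ℝ) : ℂ := A D u / planarRadius D u

lemma wave_eq_exp_mul_waveEnvelope (A : ℝ → ℝ → ℂ) (D u : ℝ) :
    wave A D u =
      Complex.exp ((2 * Real.pi * planarRadius D u : ℝ) * Complex.I) * waveEnvelope A D u := by
  rw [wave, losGain, waveEnvelope,
    show losWavenumber * planarRadius D u = (2 * Real.pi * planarRadius D u : ℝ) * Complex.I by
      push_cast; ring]
  ring

lemma wave_mul_conj_wave (A : ℝ → ℝ → ℂ) (D D' u u' : ℝ) :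
    wave A D u * conj (wave A D' u') =
      Complex.exp ((2 * Real.pi * (planarRadius D u - planarRadius D' u') : ℝ) * Complex.I) *
        (waveEnvelope A D u * conj (waveEnvelope A D' u')) := by
  rw [wave_eq_exp_mul_waveEnvelope, wave_eq_exp_mul_waveEnvelope, map_mul, ← Complex.exp_conj,
    map_mul, Complex.conj_ofReal, Complex.conj_I, mul_mul_mul_comm, ← Complex.exp_add]
  push_cast
  ring_nf

namespace IsSymbolWith

lemma norm_waveEnvelope_le (hA : IsSymbolWith C A) (hD : 1 ≤ D) (u : ℝ) :
    ‖waveEnvelope A D u‖ ≤ C / D := by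
  have hD0 := one_pos.trans_le hD
  rw [waveEnvelope, norm_div, Complex.norm_of_nonneg (planarRadius_pos hD0 u).le]
  exact div_le_div₀ hA.nonneg (hA.norm_le D hD u) hD0 (le_planarRadius D u)

lemma contDiff_waveEnvelope (hA : IsSymbolWith C A) (hD : 1 ≤ D) :
    ContDiff ℝ 1 (waveEnvelope A D) := by
  have hD0 := one_pos.trans_le hD
  have hinv : ContDiff ℝ 1 fun u => (planarRadius D u : ℂ)⁻¹ :=
    (Complex.ofRealCLM.contDiff.comp (contDiff_planarRadius hD0)).inv fun u =>
      Complex.ofReal_ne_zero.2 (planarRadius_pos hD0 u).ne'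
  rw [show waveEnvelope A D = fun u => A D u * (planarRadius D u : ℂ)⁻¹ from
    funext fun u => div_eq_mul_inv _ _]
  exact (hA.contDiff D hD).mul hinv

lemma hasDerivAt_waveEnvelope_sub (hA : IsSymbolWith C A) (hD : 1 ≤ D) (τ s : ℝ) :
    HasDerivAt (fun s => waveEnvelope A D (s - τ)) (deriv (waveEnvelope A D) (s - τ)) s :=
  ((hA.contDiff_waveEnvelope hD).differentiable one_ne_zero
    (s - τ)).hasDerivAt.comp_sub_const s τ

lemma continuous_waveEnvelope_sub (hA : IsSymbolWith C A) (hD : 1 ≤ D) (τ : ℝ) :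
    Continuous fun s => waveEnvelope A D (s - τ) :=
  (hA.contDiff_waveEnvelope hD).continuous.comp (by fun_prop)

lemma continuous_deriv_waveEnvelope_sub (hA : IsSymbolWith C A) (hD : 1 ≤ D) (τ : ℝ) :
    Continuous fun s => deriv (waveEnvelope A D) (s - τ) :=
  ((hA.contDiff_waveEnvelope hD).continuous_deriv le_rfl).comp (by fun_prop)

lemma norm_deriv_waveEnvelope_le (hA : IsSymbolWith C A) (hD : 1 ≤ D) (u : ℝ) :
    ‖deriv (waveEnvelope A D) u‖ ≤ 2 * C / D ^ 2 := by
  have hD0 := one_pos.trans_le hD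
  have hr := planarRadius_pos hD0 u
  have hderiv := (hA.differentiableAt hD u).hasDerivAt.div
    (hasDerivAt_planarRadius_snd hD0 u).ofReal_comp (Complex.ofReal_ne_zero.2 hr.ne')
  have hnorm := norm_quotient_rule_le (g := planarRadius D u) (g' := planarSin D u) hD0
    ((le_planarRadius D u).trans_eq (Complex.norm_of_nonneg hr.le).symm) (hA.norm_le D hD u)
    (hA.norm_deriv_le D hD u) ((Complex.norm_real _).trans_le (abs_planarSin_le_one hD0 u))
  calc ‖deriv (waveEnvelope A D) u‖ ≤ C / D / D + C * 1 / D ^ 2 := by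
        rwa [← hderiv.deriv] at hnorm
    _ = 2 * C / D ^ 2 := by field_simp; ring

end IsSymbolWith

lemma le_abs_planarSin_sub (hδ : 0 < δ) (hΛ : 0 < Λ) (hD : D ∈ Set.Icc δ (Λ * δ)) (hD' : δ ≤ D')
    (hDD' : |D - D'| ≤ 1) (hu : |u| ≤ Λ * δ) (hu' : |u'| ≤ Λ * δ) (hfar : 16 * Λ ^ 3 ≤ |u - u'|) :
    |u - u'| / (16 * Λ ^ 3 * δ) ≤ |planarSin D u - planarSin D' u'| := by
  have hD0 := hδ.trans_le hD.1
  have hr := planarRadius_pos hD0 (Λ * δ)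
  have hr_le : planarRadius D (Λ * δ) ≤ 2 * (Λ * δ) :=
    Real.sqrt_le_iff.2 ⟨by positivity, by nlinarith [hD.2]⟩
  have htrans : |u - u'| / (8 * Λ ^ 3 * δ) ≤ |planarSin D u - planarSin D u'| := by
    refine le_trans ?_ (mul_abs_sub_le_abs_planarSin_sub hD0 hu hu')
    calc |u - u'| / (8 * Λ ^ 3 * δ) = δ ^ 2 / (2 * (Λ * δ)) ^ 3 * |u - u'| := by
          field_simp
          norm_num
      _ ≤ D ^ 2 / planarRadius D (Λ * δ) ^ 3 * |u - u'| := by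
          gcongr
          exact hD.1
  have hlong : |planarSin D u' - planarSin D' u'| ≤ |u - u'| / (16 * Λ ^ 3 * δ) :=
    calc |planarSin D u' - planarSin D' u'| ≤ δ⁻¹ * |D - D'| :=
          abs_planarSin_sub_le_fst hδ hD.1 hD' u'
      _ ≤ δ⁻¹ * 1 := by gcongr
      _ ≤ |u - u'| / (16 * Λ ^ 3 * δ) := by
          rw [le_div_iff₀ (by positivity)]
          calc δ⁻¹ * 1 * (16 * Λ ^ 3 * δ) = 16 * Λ ^ 3 := by field_simp
            _ ≤ |u - u'| := hfar
  have hhalf : |u - u'| / (8 * Λ ^ 3 * δ) = 2 * (|u - u'| / (16 * Λ ^ 3 * δ)) := by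
    field_simp
    ring
  have htriangle := abs_sub_abs_le_abs_sub (planarSin D u - planarSin D u')
    (planarSin D' u' - planarSin D u')
  rw [abs_sub_comm (planarSin D' u'), sub_sub_sub_cancel_right] at htriangle
  linarith

lemma abs_planarCurvature_sub_le (hδ : 0 < δ) (hD : δ ≤ D) (hD' : δ ≤ D') (u u' : ℝ) :
    |planarCurvature D u - planarCurvature D' u'| ≤ 3 / δ ^ 2 * (|u - u'| + |D - D'|) := by
  calc |planarCurvature D u - planarCurvature D' u'|
      ≤ |planarCurvature D u - planarCurvature D u'| +
        |planarCurvature D u' - planarCurvature D' u'| := abs_sub_le _ _ _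
    _ ≤ 3 / D ^ 2 * |u - u'| + 3 / δ ^ 2 * |D - D'| :=
        add_le_add (abs_planarCurvature_sub_le_snd (hδ.trans_le hD) u u')
          (abs_planarCurvature_sub_le_fst hδ hD hD' u')
    _ ≤ 3 / δ ^ 2 * |u - u'| + 3 / δ ^ 2 * |D - D'| := by gcongr
    _ = 3 / δ ^ 2 * (|u - u'| + |D - D'|) := by ring

namespace IsSymbolWith

lemma norm_waveEnvelope_mul_conj_le (hA : IsSymbolWith C A) (hδ : 1 ≤ δ) (hD : δ ≤ D)
    (hD' : δ ≤ D') (u u' : ℝ) :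
    ‖waveEnvelope A D u * conj (waveEnvelope A D' u')‖ ≤ C ^ 2 / δ ^ 2 := by
  have hC := hA.nonneg
  have hδ0 := one_pos.trans_le hδ
  have hD0' := hδ0.trans_le hD'
  calc ‖waveEnvelope A D u * conj (waveEnvelope A D' u')‖ ≤ C / D * (C / D') :=
        norm_mul_le_of_le (hA.norm_waveEnvelope_le (hδ.trans hD) u)
          ((RCLike.norm_conj _).trans_le (hA.norm_waveEnvelope_le (hδ.trans hD') u'))
    _ ≤ C / δ * (C / δ) := by gcongr
    _ = C ^ 2 / δ ^ 2 := by ring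

lemma norm_deriv_waveEnvelope_mul_conj_le (hA : IsSymbolWith C A) (hδ : 1 ≤ δ) (hD : δ ≤ D)
    (hD' : δ ≤ D') (u u' : ℝ) :
    ‖deriv (waveEnvelope A D) u * conj (waveEnvelope A D' u') +
        waveEnvelope A D u * conj (deriv (waveEnvelope A D') u')‖ ≤ 4 * C ^ 2 / δ ^ 3 := by
  have hC := hA.nonneg
  have hδ0 := one_pos.trans_le hδ
  have hD0' := hδ0.trans_le hD'
  calc _ ≤ 2 * C / D ^ 2 * (C / D') + C / D * (2 * C / D' ^ 2) := norm_add_le_of_le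
        (norm_mul_le_of_le (hA.norm_deriv_waveEnvelope_le (hδ.trans hD) u)
          ((RCLike.norm_conj _).trans_le (hA.norm_waveEnvelope_le (hδ.trans hD') u')))
        (norm_mul_le_of_le (hA.norm_waveEnvelope_le (hδ.trans hD) u)
          ((RCLike.norm_conj _).trans_le (hA.norm_deriv_waveEnvelope_le (hδ.trans hD') u')))
    _ ≤ 2 * C / δ ^ 2 * (C / δ) + C / δ * (2 * C / δ ^ 2) := by gcongr
    _ = 4 * C ^ 2 / δ ^ 3 := by ring

lemma norm_integral_wave_mul_conj_le (hA : IsSymbolWith C A) (hδ : 1 ≤ δ) (hD : δ ≤ D)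
    (hD' : δ ≤ D') (hαβ : α ≤ β) :
    ‖∫ s in α..β, wave A D (s - t) * conj (wave A D' (s - t'))‖ ≤ C ^ 2 / δ ^ 2 * (β - α) := by
  rw [← abs_of_nonneg (sub_nonneg.2 hαβ)]
  refine intervalIntegral.norm_integral_le_of_norm_le_const fun s _ => ?_
  rw [wave_mul_conj_wave, norm_mul, Complex.norm_exp_ofReal_mul_I, one_mul]
  exact hA.norm_waveEnvelope_mul_conj_le hδ hD hD' _ _

lemma norm_integral_wave_mul_conj_le_of_phase (hA : IsSymbolWith C A) {l κ : ℝ} (hδ : 1 ≤ δ)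
    (hD : δ ≤ D) (hD' : δ ≤ D') (hαβ : α ≤ β) (hl : 0 < l)
    (hphase : ∀ s ∈ Set.Icc α β, l ≤ |planarSin D (s - t) - planarSin D' (s - t')|)
    (hcurv : ∀ s ∈ Set.Icc α β, |planarCurvature D (s - t) - planarCurvature D' (s - t')| ≤ κ) :
    ‖∫ s in α..β, wave A D (s - t) * conj (wave A D' (s - t'))‖ ≤
      2 * (C ^ 2 / δ ^ 2 / l) +
        (4 * C ^ 2 / δ ^ 3 / l + C ^ 2 / δ ^ 2 * κ / l ^ 2) * (β - α) := by
  have hD0 : 0 < D := one_pos.trans_le (hδ.trans hD)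
  have hD0' : 0 < D' := one_pos.trans_le (hδ.trans hD')
  have hκ : 0 ≤ κ := (abs_nonneg _).trans (hcurv α (Set.left_mem_Icc.2 hαβ))
  have hpi : 1 ≤ 2 * Real.pi := by linarith [Real.pi_gt_three]
  have habs (z : ℝ) : |2 * Real.pi * z| = 2 * Real.pi * |z| := by
    rw [abs_mul, abs_of_pos (by positivity)]
  have henv {E : ℝ} (hE : δ ≤ E) (τ : ℝ) := hA.continuous_waveEnvelope_sub (hδ.trans hE) τ
  have henv' {E : ℝ} (hE : δ ≤ E) (τ : ℝ) := hA.continuous_deriv_waveEnvelope_sub (hδ.trans hE) τ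
  have hcurv_cont {E : ℝ} (hE : 0 < E) (τ : ℝ) : Continuous fun s => planarCurvature E (s - τ) :=
    (continuous_planarCurvature hE).comp (by fun_prop)
  simp only [wave_mul_conj_wave]
  refine (norm_integral_exp_mul_I_le hαβ (l := 2 * Real.pi * l) (κ := 2 * Real.pi * κ)
    (by positivity)
    (fun s _ => (((hasDerivAt_planarRadius_snd hD0 (s - t)).comp_sub_const s t).sub
      ((hasDerivAt_planarRadius_snd hD0' (s - t')).comp_sub_const s t')).const_mul (2 * Real.pi))
    (fun s _ => (((hasDerivAt_planarSin_snd hD0 (s - t)).comp_sub_const s t).sub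
      ((hasDerivAt_planarSin_snd hD0' (s - t')).comp_sub_const s t')).const_mul (2 * Real.pi))
    (continuous_const.mul ((hcurv_cont hD0 t).sub (hcurv_cont hD0' t'))).continuousOn
    (fun s _ => (hA.hasDerivAt_waveEnvelope_sub (hδ.trans hD) t s).mul
      (hA.hasDerivAt_waveEnvelope_sub (hδ.trans hD') t' s).star)
    (((henv' hD t).mul (henv hD' t').star).add ((henv hD t).mul (henv' hD' t').star)).continuousOn
    (fun s hs => (mul_le_mul_of_nonneg_left (hphase s hs) (by positivity)).trans_eq (habs _).symm)
    (fun s hs => (habs _).trans_le (mul_le_mul_of_nonneg_left (hcurv s hs) (by positivity)))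
    (fun s _ => hA.norm_waveEnvelope_mul_conj_le hδ hD hD' _ _)
    (fun s _ => hA.norm_deriv_waveEnvelope_mul_conj_le hδ hD hD' _ _)).trans ?_
  calc _ = (2 * (C ^ 2 / δ ^ 2 / l) +
        (4 * C ^ 2 / δ ^ 3 / l + C ^ 2 / δ ^ 2 * κ / l ^ 2) * (β - α)) / (2 * Real.pi) := by
        field_simp
    _ ≤ _ := by
        have := one_pos.trans_le hδ
        have := sub_nonneg.2 hαβ
        exact div_le_self (by positivity) hpi

lemma norm_integral_wave_mul_conj_le_of_far (hA : IsSymbolWith C A) (hδ : 1 ≤ δ) (hΛ : 1 ≤ Λ)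
    (hD : D ∈ Set.Icc δ (Λ * δ)) (hD' : δ ≤ D') (hDD' : |D - D'| ≤ 1) (hαβ : α ≤ β)
    (ht : ∀ s ∈ Set.Icc α β, |s - t| ≤ Λ * δ) (ht' : ∀ s ∈ Set.Icc α β, |s - t'| ≤ Λ * δ)
    (hfar : 16 * Λ ^ 3 ≤ |t - t'|) :
    ‖∫ s in α..β, wave A D (s - t) * conj (wave A D' (s - t'))‖ ≤
      3232 * Λ ^ 7 * C ^ 2 / (δ * |t - t'|) := by
  set x := |t - t'|
  have hx1 : 1 ≤ x := by nlinarith [one_le_pow₀ hΛ (n := 3)]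
  have hδ0 := one_pos.trans_le hδ
  have hΛ0 := one_pos.trans_le hΛ
  have hdiff (s : ℝ) : |s - t - (s - t')| = x := by
    rw [sub_sub_sub_cancel_left, abs_sub_comm]
  have hlen : β - α ≤ 2 * (Λ * δ) := by
    have hα := abs_le.1 (ht α (Set.left_mem_Icc.2 hαβ))
    have hβ := abs_le.1 (ht β (Set.right_mem_Icc.2 hαβ))
    linarith
  have hcurv (s : ℝ) :
      |planarCurvature D (s - t) - planarCurvature D' (s - t')| ≤ 6 * x / δ ^ 2 := by
    calc _ ≤ 3 / δ ^ 2 * (|s - t - (s - t')| + |D - D'|) :=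
          abs_planarCurvature_sub_le hδ0 hD.1 hD' _ _
      _ ≤ 3 / δ ^ 2 * (x + x) := by
          rw [hdiff]
          gcongr
          exact hDD'.trans hx1
      _ = 6 * x / δ ^ 2 := by ring
  have hphase (s : ℝ) (hs : s ∈ Set.Icc α β) :
      x / (16 * Λ ^ 3 * δ) ≤ |planarSin D (s - t) - planarSin D' (s - t')| := by
    have hsep := le_abs_planarSin_sub hδ0 hΛ0 hD hD' hDD' (ht s hs) (ht' s hs)
    rw [hdiff] at hsep
    exact hsep hfar
  calc _ ≤ _ := hA.norm_integral_wave_mul_conj_le_of_phase hδ hD.1 hD' hαβ (by positivity)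
        hphase fun s _ => hcurv s
    _ ≤ 2 * (C ^ 2 / δ ^ 2 / (x / (16 * Λ ^ 3 * δ))) +
        (4 * C ^ 2 / δ ^ 3 / (x / (16 * Λ ^ 3 * δ)) +
          C ^ 2 / δ ^ 2 * (6 * x / δ ^ 2) / (x / (16 * Λ ^ 3 * δ)) ^ 2) * (2 * (Λ * δ)) := by
        gcongr
    _ = (32 * Λ ^ 3 + 128 * Λ ^ 4 + 3072 * Λ ^ 7) * C ^ 2 / (δ * x) := by
        field_simp
        ring
    _ ≤ (32 * Λ ^ 7 + 128 * Λ ^ 7 + 3072 * Λ ^ 7) * C ^ 2 / (δ * x) := by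
        gcongr <;> first | exact hΛ | norm_num
    _ = 3232 * Λ ^ 7 * C ^ 2 / (δ * x) := by ring

lemma norm_integral_wave_mul_conj_le_div (hA : IsSymbolWith C A) (hδ : 1 ≤ δ) (hΛ : 1 ≤ Λ)
    (hD : D ∈ Set.Icc δ (Λ * δ)) (hD' : δ ≤ D') (hDD' : |D - D'| ≤ 1) (hαβ : α ≤ β)
    (ht : ∀ s ∈ Set.Icc α β, |s - t| ≤ Λ * δ) (ht' : ∀ s ∈ Set.Icc α β, |s - t'| ≤ Λ * δ) :
    ‖∫ s in α..β, wave A D (s - t) * conj (wave A D' (s - t'))‖ ≤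
      6464 * Λ ^ 7 * C ^ 2 / (δ * (1 + |t - t'|)) := by
  have := one_pos.trans_le hδ
  have := one_pos.trans_le hΛ
  have hΛ3 : 1 ≤ Λ ^ 3 := one_le_pow₀ hΛ
  rcases le_total (16 * Λ ^ 3) |t - t'| with hfar | hnear
  · calc _ ≤ 3232 * Λ ^ 7 * C ^ 2 / (δ * |t - t'|) :=
          hA.norm_integral_wave_mul_conj_le_of_far hδ hΛ hD hD' hDD' hαβ ht ht' hfar
      _ = 6464 * Λ ^ 7 * C ^ 2 / (δ * (|t - t'| + |t - t'|)) := by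
          rw [← two_mul]
          field_simp
          ring
      _ ≤ 6464 * Λ ^ 7 * C ^ 2 / (δ * (1 + |t - t'|)) := by
          gcongr
          linarith
  · have hlen : β - α ≤ 2 * (Λ * δ) := by
      have hα := abs_le.1 (ht α (Set.left_mem_Icc.2 hαβ))
      have hβ := abs_le.1 (ht β (Set.right_mem_Icc.2 hαβ))
      linarith
    calc _ ≤ C ^ 2 / δ ^ 2 * (2 * (Λ * δ)) :=
          (hA.norm_integral_wave_mul_conj_le hδ hD.1 hD' hαβ).trans (by gcongr)
      _ = 34 * (Λ ^ 4 * C ^ 2) / (δ * (Λ ^ 3 + 16 * Λ ^ 3)) := by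
          field_simp
          ring
      _ ≤ 6464 * (Λ ^ 7 * C ^ 2) / (δ * (1 + |t - t'|)) := by
          gcongr <;> first | exact hΛ | norm_num
      _ = 6464 * Λ ^ 7 * C ^ 2 / (δ * (1 + |t - t'|)) := by ring

end IsSymbolWith

end Correlation

section Occupancy

variable {ι κ κ' : Type*} [DecidableEq κ] [DecidableEq κ'] {s : Finset ι} {f : ι → κ} {m : ℕ}

/-- Every cell `l` contains at most `m` of the nodes `j ∈ s`, the node `j` lying in the
cell `f j`. -/
def OccupancyLE (s : Finset ι) (f : ι → κ) (m : ℕ) : Prop :=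
  ∀ l, (s.filter fun j => f j = l).card ≤ m

lemma OccupancyLE.sum_comp_le {T : Finset κ} (hm : OccupancyLE s f m) (hf : ∀ j ∈ s, f j ∈ T)
    {φ : κ → ℝ} (hφ : ∀ l ∈ T, 0 ≤ φ l) : ∑ j ∈ s, φ (f j) ≤ m * ∑ l ∈ T, φ l := by
  rw [Finset.sum_comp φ f, Finset.mul_sum]
  have himage : s.image f ⊆ T := Finset.image_subset_iff.2 hf
  refine Finset.sum_le_sum_of_subset_of_nonneg himage ?_ |>.trans' ?_
  · exact fun l hl _ => mul_nonneg m.cast_nonneg (hφ l hl)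
  · refine Finset.sum_le_sum fun l hl => ?_
    rw [nsmul_eq_mul]
    exact mul_le_mul_of_nonneg_right (Nat.cast_le.2 (hm l)) (hφ l (himage hl))

lemma OccupancyLE.filter_snd {f' : ι → κ'} (hm : OccupancyLE s (fun j => (f j, f' j)) m) (i : κ) :
    OccupancyLE (s.filter fun j => f j = i) f' m := fun l => by
  simpa only [Finset.filter_filter, Prod.mk.injEq] using hm (i, l)

lemma sum_inv_one_add_abs_sub_le {a l₀ : ℤ} {N : ℕ} (hl₀ : l₀ ∈ Finset.Ico a (a + N)) :
    ∑ l ∈ Finset.Ico a (a + N), (1 + |(l₀ : ℝ) - l|)⁻¹ ≤ 2 * (1 + Real.log N) := by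
  have htwo : OccupancyLE (Finset.Ico a (a + N)) (fun l => (l₀ - l).natAbs) 2 := fun k =>
    calc _ ≤ ({l₀ - k, l₀ + k} : Finset ℤ).card := Finset.card_le_card fun l hl => by
          have hk : (l₀ - l).natAbs = k := (Finset.mem_filter.1 hl).2
          rw [Finset.mem_insert, Finset.mem_singleton]
          omega
      _ ≤ 2 := Finset.card_le_two
  calc ∑ l ∈ Finset.Ico a (a + N), (1 + |(l₀ : ℝ) - l|)⁻¹
      = ∑ l ∈ Finset.Ico a (a + N), (fun k : ℕ => (1 + (k : ℝ))⁻¹) (l₀ - l).natAbs := by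
        simp only [Nat.cast_natAbs, Int.cast_abs, Int.cast_sub]
    _ ≤ (2 : ℕ) * ∑ k ∈ Finset.range N, (1 + (k : ℝ))⁻¹ := by
        refine htwo.sum_comp_le (T := Finset.range N) (φ := fun k : ℕ => (1 + (k : ℝ))⁻¹)
          (fun l hl => ?_) fun k _ => by positivity
        rw [Finset.mem_Ico] at hl hl₀
        rw [Finset.mem_range]
        omega
    _ ≤ 2 * (1 + Real.log N) := by
        have hharmonic := harmonic_le_one_add_log N
        push_cast [harmonic] at hharmonic
        simp only [Nat.cast_ofNat, add_comm (1 : ℝ)]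
        linarith

end Occupancy

section SchurTest

variable {ι : Type*} {s : Finset ι} {W : ι → ι → ℝ} {b : ℝ}

lemma sum_sum_mul_mul_le_of_row_sum_le (hW : ∀ k ∈ s, ∀ k' ∈ s, 0 ≤ W k k')
    (hW_symm : ∀ k k', W k k' = W k' k) (hb : ∀ k ∈ s, ∑ k' ∈ s, W k k' ≤ b) (v : ι → ℝ) :
    ∑ k ∈ s, ∑ k' ∈ s, v k * v k' * W k k' ≤ b * ∑ k ∈ s, v k ^ 2 := by
  have hrow : ∑ k ∈ s, ∑ k' ∈ s, v k ^ 2 * W k k' ≤ b * ∑ k ∈ s, v k ^ 2 := by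
    rw [Finset.mul_sum]
    refine Finset.sum_le_sum fun k hk => ?_
    rw [← Finset.mul_sum, mul_comm b]
    exact mul_le_mul_of_nonneg_left (hb k hk) (sq_nonneg _)
  have hcol : ∑ k ∈ s, ∑ k' ∈ s, v k' ^ 2 * W k k' = ∑ k ∈ s, ∑ k' ∈ s, v k ^ 2 * W k k' := by
    rw [Finset.sum_comm]
    simp only [hW_symm]
  calc ∑ k ∈ s, ∑ k' ∈ s, v k * v k' * W k k'
      ≤ ∑ k ∈ s, ∑ k' ∈ s, (v k ^ 2 * W k k' + v k' ^ 2 * W k k') / 2 := by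
        refine Finset.sum_le_sum fun k hk => Finset.sum_le_sum fun k' hk' => ?_
        nlinarith [mul_nonneg (sq_nonneg (v k - v k')) (hW k hk k' hk')]
    _ = ∑ k ∈ s, ∑ k' ∈ s, v k ^ 2 * W k k' := by
        simp only [← Finset.sum_div, Finset.sum_add_distrib]
        rw [hcol, add_self_div_two]
    _ ≤ b * ∑ k ∈ s, v k ^ 2 := hrow

variable {X : Type*} [MeasurableSpace X] {μ : Measure X} {g : ι → X → ℂ}

lemma ofReal_integral_norm_sum_mul_sq
    (hg : ∀ k ∈ s, ∀ k' ∈ s, Integrable (fun x => g k x * conj (g k' x)) μ) (v : ι → ℂ) :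
    ((∫ x, ‖∑ k ∈ s, v k * g k x‖ ^ 2 ∂μ : ℝ) : ℂ) =
      ∑ k ∈ s, ∑ k' ∈ s, v k * conj (v k') * ∫ x, g k x * conj (g k' x) ∂μ := by
  have hexpand (x : X) : ((‖∑ k ∈ s, v k * g k x‖ ^ 2 : ℝ) : ℂ) =
      ∑ k ∈ s, ∑ k' ∈ s, v k * conj (v k') * (g k x * conj (g k' x)) := by
    rw [Complex.ofReal_pow, ← Complex.mul_conj', map_sum, Finset.sum_mul_sum]
    refine Finset.sum_congr rfl fun k _ => Finset.sum_congr rfl fun k' _ => ?_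
    rw [map_mul, mul_mul_mul_comm]
  have hint (k : ι) (hk : k ∈ s) (k' : ι) (hk' : k' ∈ s) := (hg k hk k' hk').const_mul
    (v k * conj (v k'))
  rw [← integral_complex_ofReal]
  simp only [hexpand]
  rw [integral_finsetSum _ fun k hk => integrable_finsetSum _ (hint k hk)]
  refine Finset.sum_congr rfl fun k hk => ?_
  rw [integral_finsetSum _ (hint k hk)]
  simp only [integral_const_mul]

lemma integral_norm_sum_mul_sq_le
    (hg : ∀ k ∈ s, ∀ k' ∈ s, Integrable (fun x => g k x * conj (g k' x)) μ)
    (hW_symm : ∀ k k', W k k' = W k' k)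
    (hgW : ∀ k ∈ s, ∀ k' ∈ s, ‖∫ x, g k x * conj (g k' x) ∂μ‖ ≤ W k k')
    (hb : ∀ k ∈ s, ∑ k' ∈ s, W k k' ≤ b) (v : ι → ℂ) :
    ∫ x, ‖∑ k ∈ s, v k * g k x‖ ^ 2 ∂μ ≤ b * ∑ k ∈ s, ‖v k‖ ^ 2 := by
  calc ∫ x, ‖∑ k ∈ s, v k * g k x‖ ^ 2 ∂μ
      ≤ ‖((∫ x, ‖∑ k ∈ s, v k * g k x‖ ^ 2 ∂μ : ℝ) : ℂ)‖ := by
        rw [Complex.norm_real]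
        exact le_abs_self _
    _ ≤ ∑ k ∈ s, ∑ k' ∈ s, ‖v k‖ * ‖v k'‖ * W k k' := by
        rw [ofReal_integral_norm_sum_mul_sq hg]
        refine norm_sum_le_of_le _ fun k hk => norm_sum_le_of_le _ fun k' hk' => ?_
        rw [norm_mul, norm_mul, RCLike.norm_conj]
        exact mul_le_mul_of_nonneg_left (hgW k hk k' hk') (by positivity)
    _ ≤ b * ∑ k ∈ s, ‖v k‖ ^ 2 := sum_sum_mul_mul_le_of_row_sum_le
        (fun k hk k' hk' => (norm_nonneg _).trans (hgW k hk k' hk')) hW_symm hb _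

end SchurTest

section SobolevSieve

variable {E : Type*} [NormedAddCommGroup E] [InnerProductSpace ℝ E] {a b u w : ℝ} {g g' : ℝ → E}

lemma norm_sq_sub_norm_sq_le_integral (hu : u ∈ Set.Icc a b) (hw : w ∈ Set.Icc a b)
    (hg : ∀ w ∈ Set.Icc a b, HasDerivAt g (g' w) w) (hg' : ContinuousOn g' (Set.Icc a b)) :
    ‖g u‖ ^ 2 - ‖g w‖ ^ 2 ≤ ∫ y in a..b, (‖g y‖ ^ 2 + ‖g' y‖ ^ 2) := by
  have hab : a ≤ b := hu.1.trans hu.2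
  have hwu : Set.uIcc w u ⊆ Set.Icc a b := Set.uIcc_subset_Icc hw hu
  have hg_cont : ContinuousOn g (Set.Icc a b) := HasDerivAt.continuousOn hg
  have hinner_le (y : ℝ) : ‖2 * inner ℝ (g y) (g' y)‖ ≤ ‖g y‖ ^ 2 + ‖g' y‖ ^ 2 := by
    rw [norm_mul, Real.norm_two]
    have hcauchy := norm_inner_le_norm (𝕜 := ℝ) (g y) (g' y)
    nlinarith [sq_nonneg (‖g y‖ - ‖g' y‖)]
  have hint : IntervalIntegrable (fun y => ‖g y‖ ^ 2 + ‖g' y‖ ^ 2) volume a b :=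
    ((hg_cont.norm.pow 2).add (hg'.norm.pow 2)).intervalIntegrable_of_Icc hab
  have hftc : ∫ y in w..u, 2 * inner ℝ (g y) (g' y) = ‖g u‖ ^ 2 - ‖g w‖ ^ 2 :=
    intervalIntegral.integral_eq_sub_of_hasDerivAt (fun y hy => (hg y (hwu hy)).norm_sq)
      (continuousOn_const.mul ((hg_cont.inner hg').mono hwu)).intervalIntegrable
  calc ‖g u‖ ^ 2 - ‖g w‖ ^ 2 ≤ ‖∫ y in w..u, 2 * inner ℝ (g y) (g' y)‖ := by
        rw [hftc]
        exact le_abs_self _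
    _ ≤ |∫ y in w..u, (‖g y‖ ^ 2 + ‖g' y‖ ^ 2)| :=
        intervalIntegral.norm_integral_le_abs_of_norm_le (.of_forall fun y => hinner_le y)
          (hint.mono_set (by rwa [Set.uIcc_of_le hab]))
    _ ≤ |∫ y in a..b, (‖g y‖ ^ 2 + ‖g' y‖ ^ 2)| := by
        refine intervalIntegral.abs_integral_mono_interval ?_ (.of_forall fun y => ?_) hint
        · rw [Set.uIoc_of_le hab]
          exact Set.Ioc_subset_Ioc (le_min hw.1 hu.1) (max_le hw.2 hu.2)
        · positivity
    _ = ∫ y in a..b, (‖g y‖ ^ 2 + ‖g' y‖ ^ 2) :=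
        abs_of_nonneg (intervalIntegral.integral_nonneg hab fun y _ => by positivity)

lemma sub_mul_norm_sq_le_integral (hu : u ∈ Set.Icc a b)
    (hg : ∀ w ∈ Set.Icc a b, HasDerivAt g (g' w) w) (hg' : ContinuousOn g' (Set.Icc a b)) :
    (b - a) * ‖g u‖ ^ 2 ≤ (b - a + 1) * ∫ w in a..b, (‖g w‖ ^ 2 + ‖g' w‖ ^ 2) := by
  have hab : a ≤ b := hu.1.trans hu.2
  have hg_sq : IntervalIntegrable (fun w => ‖g w‖ ^ 2) volume a b :=
    ((HasDerivAt.continuousOn hg).norm.pow 2).intervalIntegrable_of_Icc hab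
  have hg'_sq : IntervalIntegrable (fun w => ‖g' w‖ ^ 2) volume a b :=
    (hg'.norm.pow 2).intervalIntegrable_of_Icc hab
  set J := ∫ w in a..b, (‖g w‖ ^ 2 + ‖g' w‖ ^ 2)
  calc (b - a) * ‖g u‖ ^ 2 = ∫ _ in a..b, ‖g u‖ ^ 2 := by
        rw [intervalIntegral.integral_const, smul_eq_mul]
    _ ≤ ∫ w in a..b, (‖g w‖ ^ 2 + ‖g' w‖ ^ 2 + J) :=
        intervalIntegral.integral_mono_on hab intervalIntegrable_const
          ((hg_sq.add hg'_sq).add intervalIntegrable_const) fun w hw => by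
            have := norm_sq_sub_norm_sq_le_integral hu hw hg hg'
            nlinarith [sq_nonneg ‖g' w‖]
    _ = (b - a + 1) * J := by
        rw [intervalIntegral.integral_add (hg_sq.add hg'_sq) intervalIntegrable_const,
          intervalIntegral.integral_const, smul_eq_mul]
        ring

lemma sum_integral_unit_intervals {F : ℝ → ℝ} (hF : Continuous F) (a : ℤ) (N : ℕ) :
    ∑ l ∈ Finset.Ico a (a + N), ∫ w in (l : ℝ)..l + 1, F w = ∫ w in (a : ℝ)..a + N, F w := by
  induction N with
  | zero => simp only [Nat.cast_zero, add_zero, Finset.Ico_self, Finset.sum_empty,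
      intervalIntegral.integral_same]
  | succ N ih =>
    rw [Nat.cast_succ, ← add_assoc, ← Finset.sum_Ico_add_eq_sum_Ico_add_one (by omega), ih,
      Nat.cast_succ, ← add_assoc]
    push_cast
    exact intervalIntegral.integral_add_adjacent_intervals (hF.intervalIntegrable _ _)
      (hF.intervalIntegrable _ _)

variable {ι : Type*} {s : Finset ι}

lemma OccupancyLE.sum_norm_sq_le_integral {x : ι → ℝ} {m N : ℕ} {a : ℤ}
    (hm : OccupancyLE s (fun j => ⌊x j⌋) m) (hx : ∀ j ∈ s, ⌊x j⌋ ∈ Finset.Ico a (a + N))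
    (hg : ∀ w, HasDerivAt g (g' w) w) (hg' : Continuous g') :
    ∑ j ∈ s, ‖g (x j)‖ ^ 2 ≤ 2 * m * ∫ w in (a : ℝ)..a + N, (‖g w‖ ^ 2 + ‖g' w‖ ^ 2) := by
  have hg_cont : Continuous g := continuous_iff_continuousAt.2 fun w => (hg w).continuousAt
  have hunit (j : ι) : ‖g (x j)‖ ^ 2 ≤
      2 * ∫ w in (⌊x j⌋ : ℝ)..⌊x j⌋ + 1, (‖g w‖ ^ 2 + ‖g' w‖ ^ 2) := by
    have := sub_mul_norm_sq_le_integral ⟨Int.floor_le (x j), (Int.lt_floor_add_one _).le⟩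
      (fun w _ => hg w) hg'.continuousOn
    linarith
  calc ∑ j ∈ s, ‖g (x j)‖ ^ 2
      ≤ m * ∑ l ∈ Finset.Ico a (a + N), 2 * ∫ w in (l : ℝ)..l + 1, (‖g w‖ ^ 2 + ‖g' w‖ ^ 2) :=
        (Finset.sum_le_sum fun j _ => hunit j).trans <| hm.sum_comp_le hx
          (φ := fun l => 2 * ∫ w in (l : ℝ)..l + 1, (‖g w‖ ^ 2 + ‖g' w‖ ^ 2)) fun l _ =>
          mul_nonneg two_pos.le <| intervalIntegral.integral_nonneg (by linarith) fun w _ => by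
            positivity
    _ = 2 * m * ∫ w in (a : ℝ)..a + N, (‖g w‖ ^ 2 + ‖g' w‖ ^ 2) := by
        rw [← Finset.mul_sum, sum_integral_unit_intervals (by fun_prop)]
        ring

lemma sum_norm_sq_le_of_forall_sum_norm_sq_le {i : ℤ} {y : ι → ℝ} {G G' : ι → ℝ → E} {B : ℝ}
    (hy : ∀ j ∈ s, ⌊y j⌋ = i)
    (hG : ∀ j ∈ s, ∀ w ∈ Set.Icc (i : ℝ) (i + 1), HasDerivAt (G j) (G' j w) w)
    (hG' : ∀ j ∈ s, ContinuousOn (G' j) (Set.Icc (i : ℝ) (i + 1)))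
    (hB : ∀ w ∈ Set.Icc (i : ℝ) (i + 1), ∑ j ∈ s, (‖G j w‖ ^ 2 + ‖G' j w‖ ^ 2) ≤ B) :
    ∑ j ∈ s, ‖G j (y j)‖ ^ 2 ≤ 2 * B := by
  have hi : (i : ℝ) ≤ i + 1 := by linarith
  have hint (j : ι) (hj : j ∈ s) :
      IntervalIntegrable (fun w => ‖G j w‖ ^ 2 + ‖G' j w‖ ^ 2) volume i (i + 1) :=
    (((HasDerivAt.continuousOn (hG j hj)).norm.pow 2).add
      ((hG' j hj).norm.pow 2)).intervalIntegrable_of_Icc hi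
  calc ∑ j ∈ s, ‖G j (y j)‖ ^ 2
      ≤ ∑ j ∈ s, 2 * ∫ w in (i : ℝ)..i + 1, (‖G j w‖ ^ 2 + ‖G' j w‖ ^ 2) := by
        refine Finset.sum_le_sum fun j hj => ?_
        have hyj : y j ∈ Set.Icc (i : ℝ) (i + 1) := by
          rw [← hy j hj]
          exact ⟨Int.floor_le _, (Int.lt_floor_add_one _).le⟩
        have := sub_mul_norm_sq_le_integral hyj (hG j hj) (hG' j hj)
        linarith
    _ = 2 * ∫ w in (i : ℝ)..i + 1, ∑ j ∈ s, (‖G j w‖ ^ 2 + ‖G' j w‖ ^ 2) := by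
        rw [← Finset.mul_sum, intervalIntegral.integral_finsetSum hint]
    _ ≤ 2 * ∫ _ in (i : ℝ)..i + 1, B := by
        refine mul_le_mul_of_nonneg_left ?_ two_pos.le
        refine intervalIntegral.integral_mono_on hi ?_ intervalIntegrable_const hB
        simpa only [Finset.sum_fn] using IntervalIntegrable.sum s hint
    _ = 2 * B := by
        rw [intervalIntegral.integral_const, add_sub_cancel_left, one_smul]

end SobolevSieve

section WaveField

variable {ι κ : Type*} {s : Finset ι} {q : Finset κ} {y x : ι → ℝ} {b t : κ → ℝ} {v : κ → ℂ}
  {A A' : ℝ → ℝ → ℂ} {C δ Λ z : ℝ} {a i β : ℤ} {N m : ℕ}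

/-- The points `(b k, t k)`, `k ∈ q`, lie in the unit slab over `β` and in the transversal window
`[a, a + N)`, at most `m` of them in each unit cell. -/
structure IsSlab (q : Finset κ) (b t : κ → ℝ) (β a : ℤ) (N m : ℕ) : Prop where
  floor_fst : ∀ k ∈ q, ⌊b k⌋ = β
  floor_snd_mem : ∀ k ∈ q, ⌊t k⌋ ∈ Finset.Ico a (a + N)
  occupancyLE : OccupancyLE q (fun k => ⌊t k⌋) m

/-- The superposition at the point `(z, w)` of the waves with amplitude `A` emitted by the sources
`(b k, t k)`, `k ∈ q`, with strengths `v k`. -/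
def waveField (q : Finset κ) (v : κ → ℂ) (b t : κ → ℝ) (A : ℝ → ℝ → ℂ) (z w : ℝ) : ℂ :=
  ∑ k ∈ q, v k * wave A (z - b k) (w - t k)

lemma IsSymbolWith.continuous_waveField (hA : IsSymbolWith C A) (hz : ∀ k ∈ q, 1 ≤ z - b k) :
    Continuous (waveField q v b t A z) :=
  continuous_finsetSum _ fun k hk => continuous_const.mul <|
    (contDiff_wave hA (hz k hk)).continuous.comp (continuous_id.sub continuous_const)

lemma continuousOn_wave_longAmp_fst (u : ℝ) : ContinuousOn (wave longAmp · u) (Set.Ioi 0) := by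
  have hr : ContinuousOn (fun D => (planarRadius D u : ℂ)) (Set.Ioi 0) :=
    HasDerivAt.continuousOn fun D hD => (hasDerivAt_planarRadius_fst hD u).ofReal_comp
  have hcos : ContinuousOn (fun D => (planarCos D u : ℂ)) (Set.Ioi 0) :=
    HasDerivAt.continuousOn fun D hD => (hasDerivAt_planarCos_fst hD u).ofReal_comp
  have hr0 : ∀ D ∈ Set.Ioi (0 : ℝ), (planarRadius D u : ℂ) ≠ 0 := fun D hD =>
    Complex.ofReal_ne_zero.2 (planarRadius_pos hD u).ne'
  unfold wave longAmp radialAmp losGain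
  exact ((continuousOn_const.mul hr).cexp.div hr hr0).mul
    (hcos.mul (continuousOn_const.sub (hr.inv₀ hr0)))

lemma hasDerivAt_waveField_one_fst (hz : ∀ k ∈ q, 0 < z - b k) (w : ℝ) :
    HasDerivAt (waveField q v b t 1 · w) (waveField q v b t longAmp z w) z :=
  HasDerivAt.fun_sum fun k hk => HasDerivAt.const_mul _ <|
    (hasDerivAt_wave_one_fst (hz k hk) (w - t k)).comp_sub_const z (b k)

lemma continuousOn_waveField_longAmp_fst {S : Set ℝ} (hS : ∀ z ∈ S, ∀ k ∈ q, 0 < z - b k)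
    (w : ℝ) : ContinuousOn (waveField q v b t longAmp · w) S :=
  continuousOn_finsetSum _ fun k hk => continuousOn_const.mul <|
    (continuousOn_wave_longAmp_fst (w - t k)).comp (continuousOn_id.sub continuousOn_const)
      fun z hz => hS z hz k hk

lemma one_add_abs_floor_sub_floor_le (x y : ℝ) :
    1 + |(⌊x⌋ : ℝ) - ⌊y⌋| ≤ 2 * (1 + |x - y|) := by
  have hfract : |(⌊x⌋ : ℝ) - ⌊y⌋| ≤ |x - y| + 1 := by
    rw [abs_le]
    constructor <;> linarith [Int.floor_le x, Int.lt_floor_add_one x, Int.floor_le y,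
      Int.lt_floor_add_one y, le_abs_self (x - y), neg_abs_le (x - y)]
  linarith [abs_nonneg (x - y)]

lemma IsSlab.mem_Icc (hq : IsSlab q b t β a N m) {k : κ} (hk : k ∈ q) :
    t k ∈ Set.Icc (a : ℝ) (a + N) := by
  have hfloor := Finset.mem_Ico.1 (hq.floor_snd_mem k hk)
  rw [Int.le_floor, Int.floor_lt] at hfloor
  exact ⟨hfloor.1, by exact_mod_cast hfloor.2.le⟩

lemma IsSlab.sum_div_le (hq : IsSlab q b t β a N m) {k : κ} (hk : k ∈ q) {c : ℝ} (hc : 0 ≤ c) :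
    ∑ k' ∈ q, c / (1 + |t k - t k'|) ≤ 4 * c * m * (1 + Real.log N) := by
  calc ∑ k' ∈ q, c / (1 + |t k - t k'|)
      ≤ ∑ k' ∈ q, 2 * c * (1 + |(⌊t k⌋ : ℝ) - ⌊t k'⌋|)⁻¹ := by
        refine Finset.sum_le_sum fun k' _ => ?_
        rw [← div_eq_mul_inv, div_le_div_iff₀ (by positivity) (by positivity)]
        nlinarith [one_add_abs_floor_sub_floor_le (t k) (t k')]
    _ ≤ 2 * c * (m * ∑ l ∈ Finset.Ico a (a + N), (1 + |(⌊t k⌋ : ℝ) - l|)⁻¹) := by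
        rw [← Finset.mul_sum]
        exact mul_le_mul_of_nonneg_left (hq.occupancyLE.sum_comp_le hq.floor_snd_mem
          (φ := fun l => (1 + |(⌊t k⌋ : ℝ) - l|)⁻¹) fun l _ => by positivity) (by positivity)
    _ ≤ 2 * c * (m * (2 * (1 + Real.log N))) := by
        gcongr
        exact sum_inv_one_add_abs_sub_le (hq.floor_snd_mem k hk)
    _ = 4 * c * m * (1 + Real.log N) := by ring

lemma IsSymbolWith.integral_norm_waveField_sq_le (hA : IsSymbolWith C A) (hδ : 1 ≤ δ)
    (hΛ : 1 ≤ Λ) (hN : N ≤ Λ * δ) (hq : IsSlab q b t β a N m)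
    (hz : ∀ k ∈ q, z - b k ∈ Set.Icc δ (Λ * δ)) :
    ∫ w in (a : ℝ)..a + N, ‖waveField q v b t A z w‖ ^ 2 ≤
      25856 * Λ ^ 7 * C ^ 2 / δ * m * (1 + Real.log N) * ∑ k ∈ q, ‖v k‖ ^ 2 := by
  have haN : (a : ℝ) ≤ a + N := le_add_of_nonneg_right N.cast_nonneg
  have hcont (k : κ) (hk : k ∈ q) : Continuous fun w => wave A (z - b k) (w - t k) :=
    (contDiff_wave hA (hδ.trans (hz k hk).1)).continuous.comp (continuous_id.sub continuous_const)
  have hwindow (k : κ) (hk : k ∈ q) : ∀ w ∈ Set.Icc (a : ℝ) (a + N), |w - t k| ≤ Λ * δ :=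
    fun w hw => abs_le.2 (by
      have := hq.mem_Icc hk
      constructor <;> linarith [hw.1, hw.2, this.1, this.2])
  rw [intervalIntegral.integral_of_le haN]
  refine integral_norm_sum_mul_sq_le
    (W := fun k k' => 6464 * Λ ^ 7 * C ^ 2 / δ / (1 + |t k - t k'|)) (fun k hk k' hk' => ?_)
    (fun k k' => by rw [abs_sub_comm]) (fun k hk k' hk' => ?_) (fun k hk => ?_) v
  · exact (((hcont k hk).mul (Complex.continuous_conj.comp (hcont k' hk'))).intervalIntegrable
      _ _).1
  · have hslab : |z - b k - (z - b k')| ≤ 1 := by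
      rw [sub_sub_sub_cancel_left]
      exact (Int.abs_sub_lt_one_of_floor_eq_floor
        ((hq.floor_fst k' hk').trans (hq.floor_fst k hk).symm)).le
    rw [← intervalIntegral.integral_of_le haN, div_div]
    exact hA.norm_integral_wave_mul_conj_le_div hδ hΛ (hz k hk) (hz k' hk').1 hslab haN
      (hwindow k hk) (hwindow k' hk')
  · refine (hq.sum_div_le hk (by positivity)).trans_eq ?_
    ring

lemma IsSlab.sum_norm_waveField_sq_le_of_hasDerivAt (hs : IsSlab s y x i a N m)
    (hq : IsSlab q b t β a N m) (hA : IsSymbolWith C A) (hA' : IsSymbolWith C A')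
    (hAA' : ∀ D, 0 < D → ∀ u, HasDerivAt (wave A D) (wave A' D u) u) (hδ : 1 ≤ δ) (hΛ : 1 ≤ Λ)
    (hN : N ≤ Λ * δ) (hz : ∀ k ∈ q, z - b k ∈ Set.Icc δ (Λ * δ)) :
    ∑ j ∈ s, ‖waveField q v b t A z (x j)‖ ^ 2 ≤
      4 * m * (25856 * Λ ^ 7 * C ^ 2 / δ * m * (1 + Real.log N) * ∑ k ∈ q, ‖v k‖ ^ 2) := by
  have hz_one (k : κ) (hk : k ∈ q) : 1 ≤ z - b k := hδ.trans (hz k hk).1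
  have hderiv (w : ℝ) : HasDerivAt (waveField q v b t A z) (waveField q v b t A' z w) w :=
    HasDerivAt.fun_sum fun k hk =>
      ((hAA' _ (by linarith [hz_one k hk]) (w - t k)).comp_sub_const w (t k)).const_mul (v k)
  have hsq {A : ℝ → ℝ → ℂ} (hA : IsSymbolWith C A) :
      IntervalIntegrable (fun w => ‖waveField q v b t A z w‖ ^ 2) volume a (a + N) :=
    ((hA.continuous_waveField hz_one).norm.pow 2).intervalIntegrable _ _
  have hsieve := hs.occupancyLE.sum_norm_sq_le_integral hs.floor_snd_mem hderiv
    (hA'.continuous_waveField hz_one)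
  rw [intervalIntegral.integral_add (hsq hA) (hsq hA')] at hsieve
  have henergy := mul_le_mul_of_nonneg_left
    (add_le_add (hA.integral_norm_waveField_sq_le (v := v) hδ hΛ hN hq hz)
      (hA'.integral_norm_waveField_sq_le (v := v) hδ hΛ hN hq hz))
    (show (0 : ℝ) ≤ 2 * m by positivity)
  linarith

lemma IsSlab.sum_norm_waveField_one_sq_le (hC : IsLosConstant C) (hs : IsSlab s y x i a N m)
    (hq : IsSlab q b t β a N m) (hδ : 1 ≤ δ) (hΛ : 1 ≤ Λ) (hN : N ≤ Λ * δ)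
    (hi : ∀ z ∈ Set.Icc (i : ℝ) (i + 1), ∀ k ∈ q, z - b k ∈ Set.Icc δ (Λ * δ)) :
    ∑ j ∈ s, ‖waveField q v b t 1 (y j) (x j)‖ ^ 2 ≤
      16 * 25856 * Λ ^ 7 * C ^ 2 / δ * m ^ 2 * (1 + Real.log N) * ∑ k ∈ q, ‖v k‖ ^ 2 := by
  have hpos : ∀ z ∈ Set.Icc (i : ℝ) (i + 1), ∀ k ∈ q, 0 < z - b k := fun z hz k hk => by
    linarith [(hi z hz k hk).1]
  refine (sum_norm_sq_le_of_forall_sum_norm_sq_le (B := 8 * m *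
      (25856 * Λ ^ 7 * C ^ 2 / δ * m * (1 + Real.log N) * ∑ k ∈ q, ‖v k‖ ^ 2)) hs.floor_fst
    (fun j _ z hz => hasDerivAt_waveField_one_fst (hpos z hz) (x j))
    (fun j _ => continuousOn_waveField_longAmp_fst hpos (x j)) fun z hz => ?_).trans_eq ?_
  · have hone_le := hs.sum_norm_waveField_sq_le_of_hasDerivAt (v := v) hq hC.one hC.trans
      (fun _ => hasDerivAt_wave_one_snd) hδ hΛ hN (hi z hz)
    have hlong_le := hs.sum_norm_waveField_sq_le_of_hasDerivAt (v := v) hq hC.long hC.mixed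
      (fun _ => hasDerivAt_wave_longAmp_snd) hδ hΛ hN (hi z hz)
    rw [Finset.sum_add_distrib]
    linarith
  · ring

lemma norm_sum_sq_le_card_mul_sum_norm_sq {E : Type*} [SeminormedAddCommGroup E] (f : ι → E) :
    ‖∑ j ∈ s, f j‖ ^ 2 ≤ s.card * ∑ j ∈ s, ‖f j‖ ^ 2 :=
  (pow_le_pow_left₀ (norm_nonneg _) (norm_sum_le _ _) 2).trans sq_sum_le_card_mul_sum_sq

lemma waveField_eq_sum_fiberwise {J : Finset ℤ} (hJ : ∀ k ∈ q, ⌊b k⌋ ∈ J) (z w : ℝ) :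
    waveField q v b t A z w = ∑ β ∈ J, waveField (q.filter fun k => ⌊b k⌋ = β) v b t A z w :=
  (Finset.sum_fiberwise_of_maps_to hJ _).symm

lemma isSlab_filter (hx : ∀ j ∈ s, ⌊x j⌋ ∈ Finset.Ico a (a + N))
    (hm : OccupancyLE s (fun j => (⌊y j⌋, ⌊x j⌋)) m) (i : ℤ) :
    IsSlab (s.filter fun j => ⌊y j⌋ = i) y x i a N m where
  floor_fst _ hj := (Finset.mem_filter.1 hj).2
  floor_snd_mem j hj := hx j (Finset.mem_filter.1 hj).1
  occupancyLE := hm.filter_snd i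

lemma sum_norm_waveField_one_sq_le {I J : Finset ℤ} (hC : IsLosConstant C) (hδ : 1 ≤ δ) (hΛ : 1 ≤ Λ)
    (hN : N ≤ Λ * δ) (hI : ∀ j ∈ s, ⌊y j⌋ ∈ I) (hJ : ∀ k ∈ q, ⌊b k⌋ ∈ J)
    (hx : ∀ j ∈ s, ⌊x j⌋ ∈ Finset.Ico a (a + N)) (ht : ∀ k ∈ q, ⌊t k⌋ ∈ Finset.Ico a (a + N))
    (hs : OccupancyLE s (fun j => (⌊y j⌋, ⌊x j⌋)) m)
    (hq : OccupancyLE q (fun k => (⌊b k⌋, ⌊t k⌋)) m)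
    (hIq : ∀ i ∈ I, ∀ z ∈ Set.Icc (i : ℝ) (i + 1), ∀ k ∈ q, z - b k ∈ Set.Icc δ (Λ * δ)) :
    ∑ j ∈ s, ‖waveField q v b t 1 (y j) (x j)‖ ^ 2 ≤ I.card * J.card *
      (16 * 25856 * Λ ^ 7 * C ^ 2 / δ * m ^ 2 * (1 + Real.log N)) * ∑ k ∈ q, ‖v k‖ ^ 2 := by
  set E := 16 * 25856 * Λ ^ 7 * C ^ 2 / δ * m ^ 2 * (1 + Real.log N)
  let F (β : ℤ) := waveField (q.filter fun k => ⌊b k⌋ = β) v b t 1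
  have hblock (i : ℤ) (hi : i ∈ I) (β : ℤ) : ∑ j ∈ s.filter fun j => ⌊y j⌋ = i,
      ‖F β (y j) (x j)‖ ^ 2 ≤ E * ∑ k ∈ q.filter fun k => ⌊b k⌋ = β, ‖v k‖ ^ 2 :=
    (isSlab_filter hx hs i).sum_norm_waveField_one_sq_le hC (isSlab_filter ht hq β) hδ hΛ hN
      fun z hz k hk => hIq i hi z hz k (Finset.mem_filter.1 hk).1
  calc ∑ j ∈ s, ‖waveField q v b t 1 (y j) (x j)‖ ^ 2
      ≤ ∑ j ∈ s, J.card * ∑ β ∈ J, ‖F β (y j) (x j)‖ ^ 2 := by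
        refine Finset.sum_le_sum fun j _ => ?_
        rw [waveField_eq_sum_fiberwise hJ]
        exact norm_sum_sq_le_card_mul_sum_norm_sq _
    _ = J.card * ∑ β ∈ J, ∑ i ∈ I, ∑ j ∈ s.filter fun j => ⌊y j⌋ = i, ‖F β (y j) (x j)‖ ^ 2 := by
        rw [← Finset.mul_sum, Finset.sum_comm]
        simp only [Finset.sum_fiberwise_of_maps_to hI]
    _ ≤ J.card * ∑ β ∈ J, ∑ _i ∈ I, E * ∑ k ∈ q.filter fun k => ⌊b k⌋ = β, ‖v k‖ ^ 2 := by
        gcongr with β _ i hi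
        exact hblock i hi β
    _ = I.card * J.card * E * ∑ k ∈ q, ‖v k‖ ^ 2 := by
        simp only [Finset.sum_const, nsmul_eq_mul]
        rw [← Finset.mul_sum, ← Finset.mul_sum, Finset.sum_fiberwise_of_maps_to hJ]
        ring

end WaveField

section PlaneGeometry

/-- The rotation of the plane that sends `(cos θ, sin θ)` to the first basis vector, so that
`planeRotation θ x` lists the coordinates of `x` along `(cos θ, sin θ)` and `(-sin θ, cos θ)`. -/
def planeRotation (θ : ℝ) : Plane ≃ₗᵢ[ℝ] Plane :=
  LinearIsometry.toLinearIsometryEquiv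
    { toFun := fun x =>
        !₂[Real.cos θ * x 0 + Real.sin θ * x 1, -Real.sin θ * x 0 + Real.cos θ * x 1]
      map_add' := fun x y => by ext i; fin_cases i <;> simp <;> ring
      map_smul' := fun c x => by ext i; fin_cases i <;> simp <;> ring
      norm_map' := fun x => by
        rw [← sq_eq_sq₀ (norm_nonneg _) (norm_nonneg _), EuclideanSpace.real_norm_sq_eq,
          EuclideanSpace.real_norm_sq_eq, Fin.sum_univ_two, Fin.sum_univ_two]
        simp
        linear_combination (x 0 ^ 2 + x 1 ^ 2) * Real.sin_sq_add_cos_sq θ } rfl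

lemma planeRotation_zero (θ : ℝ) (x : Plane) :
    planeRotation θ x 0 = Real.cos θ * x 0 + Real.sin θ * x 1 := rfl

lemma planeRotation_one (θ : ℝ) (x : Plane) :
    planeRotation θ x 1 = -Real.sin θ * x 0 + Real.cos θ * x 1 := rfl

lemma measurePreserving_planeRotation_coords (θ : ℝ) :
    MeasurePreserving fun x => (planeRotation θ x 0, planeRotation θ x 1) :=
  (volume_preserving_finTwoArrow ℝ).comp
    ((PiLp.volume_preserving_ofLp (Fin 2)).comp (planeRotation θ).measurePreserving)

lemma tiltedSquare_eq_preimage (o : Plane) (θ s : ℝ) :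
    tiltedSquare o θ s = (fun x => (planeRotation θ x 0, planeRotation θ x 1)) ⁻¹'
      Metric.closedBall (planeRotation θ o 0) (s / 2) ×ˢ
      Metric.closedBall (planeRotation θ o 1) (s / 2) := by
  ext x
  simp only [tiltedSquare, Set.mem_ofPred_eq, Set.mem_preimage, Set.mem_prod,
    Metric.mem_closedBall, Real.dist_eq, planeRotation_zero, planeRotation_one]
  ring_nf

lemma measurableSet_tiltedSquare (o : Plane) (θ s : ℝ) : MeasurableSet (tiltedSquare o θ s) := by
  rw [tiltedSquare_eq_preimage]
  exact (measurePreserving_planeRotation_coords θ).measurable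
    (measurableSet_closedBall.prod measurableSet_closedBall)

lemma volume_tiltedSquare (o : Plane) (θ s : ℝ) :
    volume (tiltedSquare o θ s) = ENNReal.ofReal s * ENNReal.ofReal s := by
  rw [tiltedSquare_eq_preimage, (measurePreserving_planeRotation_coords θ).measure_preimage
    (measurableSet_closedBall.prod measurableSet_closedBall).nullMeasurableSet,
    Measure.volume_eq_prod, Measure.prod_prod, Real.volume_closedBall, Real.volume_closedBall,
    mul_div_cancel₀ s two_ne_zero]

lemma volume_tiltedSquare_sqrt (o : Plane) (θ : ℝ) (M : ℕ) :
    volume (tiltedSquare o θ √M) = M := by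
  rw [volume_tiltedSquare, ← ENNReal.ofReal_mul (Real.sqrt_nonneg _),
    Real.mul_self_sqrt M.cast_nonneg, ENNReal.ofReal_natCast]

/-- The cell of the unit grid with tilt `α` that contains `x`, encoded by its lower left corner. -/
def gridCell (α : ℝ) (x : Plane) : ℤ × ℤ := (⌊planeRotation α x 0⌋, ⌊planeRotation α x 1⌋)

lemma measurable_gridCell (α : ℝ) : Measurable (gridCell α) :=
  (Int.measurable_floor.comp measurable_fst).prodMk (Int.measurable_floor.comp measurable_snd)
    |>.comp (measurePreserving_planeRotation_coords α).measurable

lemma volume_gridCell_preimage_singleton (α : ℝ) (l : ℤ × ℤ) :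
    volume (gridCell α ⁻¹' {l}) = 1 := by
  have hcell : gridCell α ⁻¹' {l} = (fun x => (planeRotation α x 0, planeRotation α x 1)) ⁻¹'
      Set.Ico (l.1 : ℝ) (l.1 + 1) ×ˢ Set.Ico (l.2 : ℝ) (l.2 + 1) := by
    ext x
    simp only [gridCell, Set.mem_preimage, Set.mem_singleton_iff, Set.mem_prod, Set.mem_Ico,
      Prod.ext_iff, Int.floor_eq_iff]
  rw [hcell, (measurePreserving_planeRotation_coords α).measure_preimage
    (measurableSet_Ico.prod measurableSet_Ico).nullMeasurableSet, Measure.volume_eq_prod,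
    Measure.prod_prod, Real.volume_Ico, Real.volume_Ico]
  simp only [add_sub_cancel_left, ENNReal.ofReal_one, mul_one]

lemma dist_eq_planarRadius (α : ℝ) (x y : Plane) : dist x y =
    planarRadius (planeRotation α x 0 - planeRotation α y 0)
      (planeRotation α x 1 - planeRotation α y 1) := by
  rw [← (planeRotation α).dist_map, EuclideanSpace.dist_eq, Fin.sum_univ_two, planarRadius,
    Real.dist_eq, Real.dist_eq, sq_abs, sq_abs]

lemma dist_sq_eq_add_sq (α : ℝ) (x y : Plane) : dist x y ^ 2 =
    (planeRotation α x 0 - planeRotation α y 0) ^ 2 +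
      (planeRotation α x 1 - planeRotation α y 1) ^ 2 := by
  rw [dist_eq_planarRadius α, planarRadius_sq]

lemma abs_planeRotation_sub_le_of_mem_tiltedSquare {o x : Plane} {θ s : ℝ}
    (hx : x ∈ tiltedSquare o θ s) (α : ℝ) (i : Fin 2) :
    |planeRotation α x i - planeRotation α o i| ≤ 3 / 4 * s := by
  rw [tiltedSquare_eq_preimage, Set.mem_preimage, Set.mem_prod, Metric.mem_closedBall,
    Metric.mem_closedBall, Real.dist_eq, Real.dist_eq] at hx
  have hs : 0 ≤ s := by linarith [(abs_nonneg _).trans hx.1]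
  have hdist : dist x o ^ 2 ≤ s ^ 2 / 2 := by
    rw [dist_sq_eq_add_sq θ]
    linarith [sq_le_sq.2 (hx.1.trans (le_abs_self _)), sq_le_sq.2 (hx.2.trans (le_abs_self _))]
  have hcoord : (planeRotation α x i - planeRotation α o i) ^ 2 ≤ dist x o ^ 2 := by
    rw [dist_sq_eq_add_sq α]
    fin_cases i
    exacts [le_add_of_nonneg_right (sq_nonneg _), le_add_of_nonneg_left (sq_nonneg _)]
  exact abs_le_of_sq_le_sq (by nlinarith) (by positivity)

lemma exists_planeRotation_aligned (o₁ o₂ : Plane) :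
    ∃ α, planeRotation α o₁ 0 - planeRotation α o₂ 0 = dist o₁ o₂ ∧
      planeRotation α o₁ 1 = planeRotation α o₂ 1 := by
  set z : ℂ := ⟨o₁ 0 - o₂ 0, o₁ 1 - o₂ 1⟩
  have hz : ‖z‖ = dist o₁ o₂ := by
    rw [← sq_eq_sq₀ (norm_nonneg _) dist_nonneg, ← Complex.normSq_eq_norm_sq,
      Complex.normSq_apply, EuclideanSpace.dist_eq, Real.sq_sqrt (by positivity), Fin.sum_univ_two,
      Real.dist_eq, Real.dist_eq, sq_abs, sq_abs, sq, sq]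
  have hre : o₁ 0 - o₂ 0 = dist o₁ o₂ * Real.cos z.arg := by
    rw [← hz, Complex.norm_mul_cos_arg]
  have him : o₁ 1 - o₂ 1 = dist o₁ o₂ * Real.sin z.arg := by
    rw [← hz, Complex.norm_mul_sin_arg]
  refine ⟨z.arg, ?_, ?_⟩ <;> simp only [planeRotation_zero, planeRotation_one]
  · linear_combination Real.cos z.arg * hre + Real.sin z.arg * him +
      dist o₁ o₂ * Real.sin_sq_add_cos_sq z.arg
  · linear_combination -Real.sin z.arg * hre + Real.cos z.arg * him

end PlaneGeometry

section Covering

variable {M : ℕ} {α θ c y : ℝ} {o x : Plane}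

/-- A window of fewer than `2 √M` unit intervals around `c`; for `16 ≤ M` it covers the interval of
radius `3 / 4 * √M`, hence the projection of a square of area `M` with centre over `c`. -/
def cellWindow (M : ℕ) (c : ℝ) : Finset ℤ :=
  Finset.Ico ⌊c - 3 / 4 * √M⌋ (⌊c - 3 / 4 * √M⌋ + ⌊2 * √M⌋₊)

lemma card_cellWindow (M : ℕ) (c : ℝ) : (cellWindow M c).card = ⌊2 * √M⌋₊ := by
  rw [cellWindow, Int.card_Ico, add_sub_cancel_left, Int.toNat_natCast]

lemma cast_card_cellWindow_le (M : ℕ) (c : ℝ) : ((cellWindow M c).card : ℝ) ≤ 2 * √M := by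
  rw [card_cellWindow]
  exact Nat.floor_le (by positivity)

lemma four_le_sqrt (hM : 16 ≤ M) : 4 ≤ √(M : ℝ) :=
  Real.le_sqrt_of_sq_le (by norm_num; exact_mod_cast hM)

lemma floor_mem_cellWindow (hM : 16 ≤ M) (hy : |y - c| ≤ 3 / 4 * √M) : ⌊y⌋ ∈ cellWindow M c := by
  have hy := abs_le.1 hy
  rw [cellWindow, Finset.mem_Ico, Int.floor_lt]
  refine ⟨Int.floor_mono (by linarith), ?_⟩
  push_cast
  linarith [four_le_sqrt hM, Int.lt_floor_add_one (c - 3 / 4 * √M), Nat.lt_floor_add_one (2 * √M)]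

lemma mem_Icc_of_mem_cellWindow {i : ℤ} (hi : i ∈ cellWindow M c)
    (hy : y ∈ Set.Icc (i : ℝ) (i + 1)) :
    y ∈ Set.Icc (c - 3 / 4 * √M - 1) (c + 5 / 4 * √M) := by
  rw [cellWindow, Finset.mem_Ico] at hi
  have hleft : (⌊c - 3 / 4 * √M⌋ : ℝ) ≤ i := by exact_mod_cast hi.1
  have hright : (i + 1 : ℝ) ≤ ⌊c - 3 / 4 * √M⌋ + ⌊2 * √M⌋₊ := by exact_mod_cast hi.2
  have hwidth : (⌊2 * √M⌋₊ : ℝ) ≤ 2 * √M := Nat.floor_le (by positivity)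
  constructor <;> linarith [hy.1, hy.2, Int.lt_floor_add_one (c - 3 / 4 * √M),
    Int.floor_le (c - 3 / 4 * √M)]

/-- The cells of the unit grid with tilt `α` near the point `o`. -/
def cellBlock (M : ℕ) (α : ℝ) (o : Plane) : Finset (ℤ × ℤ) :=
  cellWindow M (planeRotation α o 0) ×ˢ cellWindow M (planeRotation α o 1)

lemma gridCell_mem_cellBlock (hM : 16 ≤ M) (hx : x ∈ tiltedSquare o θ √M) (α : ℝ) :
    gridCell α x ∈ cellBlock M α o :=
  Finset.mk_mem_product
    (floor_mem_cellWindow hM (abs_planeRotation_sub_le_of_mem_tiltedSquare hx α 0))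
    (floor_mem_cellWindow hM (abs_planeRotation_sub_le_of_mem_tiltedSquare hx α 1))

lemma card_cellBlock_le (M : ℕ) (α : ℝ) (o : Plane) : ((cellBlock M α o).card : ℝ) ≤ 4 * M := by
  rw [cellBlock, Finset.card_product, Nat.cast_mul]
  nlinarith [cast_card_cellWindow_le M (planeRotation α o 0),
    cast_card_cellWindow_le M (planeRotation α o 1), Real.sq_sqrt (M.cast_nonneg (α := ℝ)),
    Real.sqrt_nonneg M]

end Covering

section Deterministic

lemma spectralNormOf_sq_le {M : ℕ} {H : Matrix (Fin M) (Fin M) ℂ} {B : ℝ} (hB : 0 ≤ B)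
    (hH : ∀ v : Fin M → ℂ, ∑ j, ‖∑ k, v k * H j k‖ ^ 2 ≤ B * ∑ k, ‖v k‖ ^ 2) :
    spectralNormOf H ^ 2 ≤ B := by
  have hnorm : spectralNormOf H ≤ √B := by
    refine ContinuousLinearMap.opNorm_le_bound _ (Real.sqrt_nonneg _) fun v => ?_
    refine le_of_sq_le_sq ?_ (by positivity)
    rw [mul_pow, Real.sq_sqrt hB, EuclideanSpace.norm_sq_eq, EuclideanSpace.norm_sq_eq,
      Matrix.ofLp_toEuclideanCLM]
    simpa only [Matrix.mulVec, dotProduct, mul_comm] using hH v.ofLp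
  exact Real.sq_sqrt hB ▸ pow_le_pow_left₀ (norm_nonneg _) hnorm 2

lemma sum_mul_losMatrix_eq_waveField {M : ℕ} (α : ℝ) (x y : Fin M → Plane) (v : Fin M → ℂ)
    (j : Fin M) : ∑ k, v k * losMatrix x y j k =
      waveField Finset.univ v (fun k => planeRotation α (y k) 0) (fun k => planeRotation α (y k) 1)
        1 (planeRotation α (x j) 0) (planeRotation α (x j) 1) := by
  simp only [losMatrix, Matrix.of_apply, waveField, wave_one, losGain, ← dist_eq_planarRadius]

lemma IsLosConstant.spectralNormOf_losMatrix_sq_le {C : ℝ} (hC : IsLosConstant C) {M m : ℕ}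
    (hM : 16 ≤ M) {d α θ₁ θ₂ : ℝ} {o₁ o₂ : Plane} (hd : 2 * √M ≤ d)
    (hα₀ : planeRotation α o₁ 0 - planeRotation α o₂ 0 = d)
    (hα₁ : planeRotation α o₁ 1 = planeRotation α o₂ 1) {x y : Fin M → Plane}
    (hx : ∀ j, x j ∈ tiltedSquare o₁ θ₁ √M) (hy : ∀ k, y k ∈ tiltedSquare o₂ θ₂ √M)
    (hxm : OccupancyLE Finset.univ (fun j => gridCell α (x j)) m)
    (hym : OccupancyLE Finset.univ (fun k => gridCell α (y k)) m) :
    spectralNormOf (losMatrix x y) ^ 2 ≤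
      512 * 25856 * 16 ^ 7 * C ^ 2 * (M * m ^ 2 * (1 + Real.log M) / d) := by
  have hL := four_le_sqrt hM
  have hLsq : √(M : ℝ) ^ 2 = M := Real.sq_sqrt M.cast_nonneg
  have hN : (⌊2 * √(M : ℝ)⌋₊ : ℝ) ≤ 2 * √M := Nat.floor_le (by positivity)
  have hlog : Real.log ⌊2 * √(M : ℝ)⌋₊ ≤ Real.log M := by
    have hpos : 0 < ⌊2 * √(M : ℝ)⌋₊ := Nat.floor_pos.2 (by linarith)
    exact Real.log_le_log (by exact_mod_cast hpos) (by nlinarith)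
  have hlog_nonneg : 0 ≤ Real.log M := Real.log_natCast_nonneg M
  have hd_pos : 0 < d := by linarith
  have hfloor₀ {o z : Plane} {θ : ℝ} (hz : z ∈ tiltedSquare o θ √M) :=
    Finset.mem_product.1 (gridCell_mem_cellBlock hM hz α)
  refine spectralNormOf_sq_le (by positivity) fun v => ?_
  simp only [sum_mul_losMatrix_eq_waveField α]
  refine (sum_norm_waveField_one_sq_le (a := ⌊planeRotation α o₁ 1 - 3 / 4 * √M⌋) (δ := d / 8)
    (Λ := 16) hC (by linarith) (by norm_num) (hN.trans (by linarith))
    (fun j _ => (hfloor₀ (hx j)).1) (fun k _ => (hfloor₀ (hy k)).1)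
    (fun j _ => (hfloor₀ (hx j)).2) (fun k _ => hα₁ ▸ (hfloor₀ (hy k)).2) hxm hym
    fun i hi z hz k _ => ?_).trans ?_
  · have hz := mem_Icc_of_mem_cellWindow hi hz
    have hyk := abs_le.1 (abs_planeRotation_sub_le_of_mem_tiltedSquare (hy k) α 0)
    constructor <;> linarith [hz.1, hz.2, hyk.1, hyk.2]
  · refine mul_le_mul_of_nonneg_right ?_ (Finset.sum_nonneg fun _ _ => by positivity)
    calc _ ≤ 2 * √M * (2 * √M) *
          (16 * 25856 * 16 ^ 7 * C ^ 2 / (d / 8) * m ^ 2 * (1 + Real.log M)) := by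
          gcongr <;> exact cast_card_cellWindow_le _ _
      _ = 512 * 25856 * 16 ^ 7 * C ^ 2 * (√M ^ 2 * m ^ 2 * (1 + Real.log M) / d) := by ring
      _ = _ := by rw [hLsq]

end Deterministic

section RandomOccupancy

variable {Ω ι κ : Type*} [MeasurableSpace Ω] {P : Measure Ω} [MeasurableSpace κ]
  [MeasurableSingletonClass κ] {F : ι → Ω → κ} {q : ℝ}

lemma measureReal_biInter_preimage_singleton_le (hF : iIndepFun F P) {l : κ}
    (hq : ∀ j, P.real (F j ⁻¹' {l}) ≤ q) (s : Finset ι) :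
    P.real (⋂ j ∈ s, F j ⁻¹' {l}) ≤ q ^ s.card := by
  rw [measureReal_def, hF.measure_inter_preimage_eq_mul s fun _ _ => measurableSet_singleton l,
    ENNReal.toReal_prod, ← Finset.prod_const]
  exact Finset.prod_le_prod (fun _ _ => ENNReal.toReal_nonneg) fun j _ => hq j

variable [IsProbabilityMeasure P] [Fintype ι] [DecidableEq κ]

lemma measureReal_le_card_filter_le (hF : iIndepFun F P) {l : κ}
    (hq : ∀ j, P.real (F j ⁻¹' {l}) ≤ q) (n : ℕ) :
    P.real {ω | n ≤ (Finset.univ.filter fun j => F j ω = l).card} ≤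
      (Fintype.card ι).choose n * q ^ n := by
  have hsub : {ω | n ≤ (Finset.univ.filter fun j => F j ω = l).card} ⊆
      ⋃ s ∈ Finset.powersetCard n Finset.univ, ⋂ j ∈ s, F j ⁻¹' {l} := fun ω hω => by
    obtain ⟨s, hs, hsn⟩ := Finset.exists_subset_card_eq hω
    exact Set.mem_biUnion (Finset.mem_powersetCard.2 ⟨Finset.subset_univ s, hsn⟩)
      (Set.mem_iInter₂.2 fun j hj => (Finset.mem_filter.1 (hs hj)).2)
  calc _ ≤ ∑ s ∈ Finset.powersetCard n Finset.univ, P.real (⋂ j ∈ s, F j ⁻¹' {l}) :=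
        (measureReal_mono hsub (measure_ne_top _ _)).trans (measureReal_biUnion_finset_le _ _)
    _ ≤ (Finset.powersetCard n (Finset.univ : Finset ι)).card • q ^ n :=
        Finset.sum_le_card_nsmul _ _ _ fun s hs =>
          (Finset.mem_powersetCard.1 hs).2 ▸ measureReal_biInter_preimage_singleton_le hF hq s
    _ = _ := by rw [Finset.card_powersetCard, Finset.card_univ, nsmul_eq_mul]

lemma measureReal_not_occupancyLE_le (hF : iIndepFun F P) {T : Finset κ}
    (hT : ∀ j, ∀ᵐ ω ∂P, F j ω ∈ T) (hq : ∀ j l, P.real (F j ⁻¹' {l}) ≤ q) (m : ℕ) :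
    P.real {ω | ¬OccupancyLE Finset.univ (fun j => F j ω) m} ≤
      T.card * ((Fintype.card ι).choose (m + 1) * q ^ (m + 1)) := by
  have hsub : {ω | ¬OccupancyLE Finset.univ (fun j => F j ω) m} ≤ᵐ[P]
      ⋃ l ∈ T, {ω | m + 1 ≤ (Finset.univ.filter fun j => F j ω = l).card} := by
    filter_upwards [ae_all_iff.2 hT] with ω hωT hω
    obtain ⟨l, hl⟩ := not_forall.1 hω
    obtain ⟨j, hj⟩ := Finset.card_pos.1 (Nat.zero_lt_of_lt (not_le.1 hl))
    exact Set.mem_biUnion ((Finset.mem_filter.1 hj).2 ▸ hωT j) (Nat.succ_le_of_lt (not_le.1 hl))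
  calc _ ≤ ∑ l ∈ T, P.real {ω | m + 1 ≤ (Finset.univ.filter fun j => F j ω = l).card} :=
        (ENNReal.toReal_mono (measure_ne_top _ _) (measure_mono_ae hsub)).trans
          (measureReal_biUnion_finset_le _ _)
    _ ≤ T.card • ((Fintype.card ι).choose (m + 1) * q ^ (m + 1)) :=
        Finset.sum_le_card_nsmul _ _ _ fun _ _ => measureReal_le_card_filter_le hF (hq · _) _
    _ = _ := nsmul_eq_mul _ _

end RandomOccupancy

lemma choose_mul_inv_pow_le_inv_factorial (M n : ℕ) :
    M.choose n * (M : ℝ)⁻¹ ^ n ≤ (n.factorial : ℝ)⁻¹ := by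
  rcases M.eq_zero_or_pos with rfl | hM
  · rcases n.eq_zero_or_pos with rfl | hn
    · simp
    · simp [Nat.choose_eq_zero_of_lt hn]
  calc _ ≤ (M : ℝ) ^ n / n.factorial * (M : ℝ)⁻¹ ^ n := by
        gcongr
        exact Nat.choose_le_pow_div n M
    _ = _ := by
        rw [inv_pow]
        field_simp

section UniformCluster

variable {Ω : Type*} [MeasurableSpace Ω] {P : Measure Ω} {M : ℕ} {o : Plane} {θ : ℝ}

lemma measureReal_preimage_of_isUniform_tiltedSquare {ξ : Ω → Plane} (hM : 1 ≤ M)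
    (hξ : pdf.IsUniform ξ (tiltedSquare o θ √M) P volume) {A : Set Plane} (hA : MeasurableSet A) :
    P.real (ξ ⁻¹' A) = volume.real (tiltedSquare o θ √M ∩ A) / M := by
  rw [measureReal_def, hξ.measure_preimage ?_ ?_ hA, volume_tiltedSquare_sqrt, ENNReal.toReal_div,
    ENNReal.toReal_natCast, measureReal_def]
  all_goals rw [volume_tiltedSquare_sqrt]
  exacts [Nat.cast_ne_zero.2 (Nat.one_le_iff_ne_zero.1 hM), ENNReal.natCast_ne_top M]

lemma ae_mem_of_isUniform_tiltedSquare {ξ : Ω → Plane} [IsProbabilityMeasure P] (hM : 1 ≤ M)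
    (hξ : pdf.IsUniform ξ (tiltedSquare o θ √M) P volume) :
    ∀ᵐ ω ∂P, ξ ω ∈ tiltedSquare o θ √M := by
  have hcompl := measureReal_preimage_of_isUniform_tiltedSquare hM hξ
    (measurableSet_tiltedSquare o θ √M).compl
  rw [Set.inter_compl_self, measureReal_empty, zero_div] at hcompl
  exact (measureReal_eq_zero_iff).1 hcompl

lemma measureReal_gridCell_eq_le_inv {ξ : Ω → Plane} (hM : 1 ≤ M)
    (hξ : pdf.IsUniform ξ (tiltedSquare o θ √M) P volume) (α : ℝ) (l : ℤ × ℤ) :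
    P.real ((fun ω => gridCell α (ξ ω)) ⁻¹' {l}) ≤ (M : ℝ)⁻¹ := by
  have hcell : volume.real (gridCell α ⁻¹' {l}) = 1 := by
    rw [measureReal_def, volume_gridCell_preimage_singleton, ENNReal.toReal_one]
  change P.real (ξ ⁻¹' (gridCell α ⁻¹' {l})) ≤ _
  rw [measureReal_preimage_of_isUniform_tiltedSquare hM hξ
    (measurable_gridCell α (measurableSet_singleton l)), ← one_div, ← hcell]
  gcongr
  · rw [volume_gridCell_preimage_singleton]
    exact ENNReal.one_ne_top
  · exact Set.inter_subset_right

lemma measureReal_not_occupancyLE_gridCell_le [IsProbabilityMeasure P] {X : Fin M → Ω → Plane}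
    (hM : 16 ≤ M) (hX : iIndepFun X P)
    (hU : ∀ j, pdf.IsUniform (X j) (tiltedSquare o θ √M) P volume) (α : ℝ) (m : ℕ) :
    P.real {ω | ¬OccupancyLE Finset.univ (fun j => gridCell α (X j ω)) m} ≤
      4 * M * (m.factorial : ℝ)⁻¹ := by
  have hM₁ : 1 ≤ M := by omega
  have hT (j : Fin M) : ∀ᵐ ω ∂P, gridCell α (X j ω) ∈ cellBlock M α o :=
    (ae_mem_of_isUniform_tiltedSquare hM₁ (hU j)).mono fun ω hω => gridCell_mem_cellBlock hM hω α
  refine (measureReal_not_occupancyLE_le (hX.comp _ fun _ => measurable_gridCell α) hT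
    (fun j l => measureReal_gridCell_eq_le_inv hM₁ (hU j) α l) m).trans ?_
  rw [Fintype.card_fin]
  gcongr
  · exact card_cellBlock_le M α o
  · refine (choose_mul_inv_pow_le_inv_factorial M (m + 1)).trans ?_
    gcongr
    exact m.le_succ

end UniformCluster

section Asymptotics

lemma inv_factorial_le {m : ℕ} (hm : 1 ≤ m) (n : ℕ) :
    (m.factorial : ℝ)⁻¹ ≤ Real.exp (Real.exp 1) * n.factorial / m ^ n := by
  have hexp_exp := Real.pow_div_factorial_le_exp (Real.exp 1) (Real.exp_pos 1).le m
  have hexp := Real.pow_div_factorial_le_exp m (Nat.cast_nonneg m) n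
  rw [Real.exp_one_pow] at hexp_exp
  have hm₀ : (0 : ℝ) < m := by exact_mod_cast hm
  rw [le_div_iff₀ (by positivity)]
  rw [div_le_iff₀ (by positivity)] at hexp
  calc (m.factorial : ℝ)⁻¹ * m ^ n ≤ (m.factorial : ℝ)⁻¹ * (Real.exp m * n.factorial) := by gcongr
    _ = Real.exp m / m.factorial * n.factorial := by ring
    _ ≤ _ := by gcongr

variable {η ε p x : ℝ}

lemma exists_inv_factorial_ceil_rpow_le (hη : 0 < η) (p : ℝ) :
    ∃ C : ℝ, 0 < C ∧ ∀ x : ℝ, 1 ≤ x → (⌈x ^ η⌉₊.factorial : ℝ)⁻¹ ≤ C * x ^ (-p) := by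
  refine ⟨Real.exp (Real.exp 1) * ⌈p / η⌉₊.factorial, by positivity, fun x hx => ?_⟩
  have hx₀ : 0 < x := by linarith
  have hpow : x ^ p ≤ (⌈x ^ η⌉₊ : ℝ) ^ ⌈p / η⌉₊ :=
    calc x ^ p ≤ x ^ (η * ⌈p / η⌉₊) :=
          Real.rpow_le_rpow_of_exponent_le hx ((div_le_iff₀' hη).1 (Nat.le_ceil _))
      _ = (x ^ η) ^ ⌈p / η⌉₊ := by rw [Real.rpow_mul hx₀.le, Real.rpow_natCast]
      _ ≤ _ := by
          gcongr
          exact Nat.le_ceil _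
  refine (inv_factorial_le (Nat.ceil_pos.2 (by positivity)) ⌈p / η⌉₊).trans ?_
  rw [Real.rpow_neg hx₀.le, ← div_eq_mul_inv]
  gcongr

lemma exists_mul_inv_factorial_ceil_rpow_le (hη : 0 < η) (p : ℝ) :
    ∃ C : ℝ, 0 < C ∧ ∀ x : ℝ, 1 ≤ x → x * (⌈x ^ η⌉₊.factorial : ℝ)⁻¹ ≤ C * x ^ (-p) := by
  obtain ⟨C, hC, hfac⟩ := exists_inv_factorial_ceil_rpow_le hη (p + 1)
  refine ⟨C, hC, fun x hx => ?_⟩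
  have hx₀ : 0 < x := by linarith
  calc _ ≤ x * (C * x ^ (-(p + 1))) := mul_le_mul_of_nonneg_left (hfac x hx) hx₀.le
    _ = C * x ^ (-p) := by
        rw [neg_add, Real.rpow_add hx₀, Real.rpow_neg_one]
        field_simp

lemma ceil_rpow_sq_mul_one_add_log_le (hε : 0 < ε) (hx : 1 ≤ x) :
    (⌈x ^ (ε / 4)⌉₊ : ℝ) ^ 2 * (1 + Real.log x) ≤ 4 * (1 + 2 / ε) * x ^ ε := by
  have hx₀ : 0 < x := by linarith
  have hone : 1 ≤ x ^ (ε / 4) := Real.one_le_rpow hx (by positivity)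
  have hceil : (⌈x ^ (ε / 4)⌉₊ : ℝ) ≤ 2 * x ^ (ε / 4) := by
    linarith [Nat.ceil_lt_add_one (zero_le_one.trans hone)]
  have hlog : 1 + Real.log x ≤ (1 + 2 / ε) * x ^ (ε / 2) := by
    have hlog_le : Real.log x ≤ 2 / ε * x ^ (ε / 2) :=
      (Real.log_le_rpow_div hx₀.le (half_pos hε)).trans_eq (by field_simp)
    linarith [Real.one_le_rpow hx (half_pos hε).le]
  have hlog₀ : 0 ≤ Real.log x := Real.log_nonneg hx
  calc _ ≤ (2 * x ^ (ε / 4)) ^ 2 * ((1 + 2 / ε) * x ^ (ε / 2)) := by gcongr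
    _ = 4 * (1 + 2 / ε) * (x ^ (ε / 4) * x ^ (ε / 4) * x ^ (ε / 2)) := by ring
    _ = 4 * (1 + 2 / ε) * x ^ ε := by
        rw [← Real.rpow_add hx₀, ← Real.rpow_add hx₀]
        ring_nf

lemma mul_ceil_rpow_sq_mul_one_add_log_div_le (hε : 0 < ε) (hx : 1 ≤ x) {d : ℝ} (hd : 0 ≤ d) :
    x * (⌈x ^ (ε / 4)⌉₊ : ℝ) ^ 2 * (1 + Real.log x) / d ≤
      4 * (1 + 2 / ε) * (x ^ (1 + ε) / d) := by
  have hx₀ : 0 < x := by linarith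
  calc _ = x / d * ((⌈x ^ (ε / 4)⌉₊ : ℝ) ^ 2 * (1 + Real.log x)) := by ring
    _ ≤ x / d * (4 * (1 + 2 / ε) * x ^ ε) :=
        mul_le_mul_of_nonneg_left (ceil_rpow_sq_mul_one_add_log_le hε hx) (by positivity)
    _ = 4 * (1 + 2 / ε) * (x ^ (1 + ε) / d) := by
        rw [Real.rpow_add hx₀, Real.rpow_one]
        ring

lemma one_le_rpow_mul_rpow_neg {y : ℝ} (hx : 0 < x) (hxy : x ≤ y) (hp : 0 ≤ p) :
    1 ≤ y ^ p * x ^ (-p) := by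
  rw [Real.rpow_neg hx.le, ← div_eq_mul_inv, one_le_div (by positivity)]
  exact Real.rpow_le_rpow hx.le hxy hp

end Asymptotics

section MainTheorem

lemma one_sub_measureReal_add_le {Ω : Type*} [MeasurableSpace Ω] {P : Measure Ω}
    [IsProbabilityMeasure P] {A B G : Set Ω} (h : ∀ᵐ ω ∂P, ω ∉ A → ω ∉ B → ω ∈ G) :
    1 - (P.real A + P.real B) ≤ P.real G := by
  have hcover : Set.univ ≤ᵐ[P] (G ∪ (A ∪ B) : Set Ω) := by
    filter_upwards [h] with ω hω _
    by_contra hnot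
    obtain ⟨hG, hAB⟩ := not_or.1 hnot
    exact hG (hω (hAB ∘ Or.inl) (hAB ∘ Or.inr))
  have hone : 1 ≤ P.real (G ∪ (A ∪ B)) := by
    rw [← probReal_univ (μ := P)]
    exact ENNReal.toReal_mono (measure_ne_top _ _) (measure_mono_ae hcover)
  linarith [measureReal_union_le (μ := P) G (A ∪ B), measureReal_union_le (μ := P) A B]

lemma IsLosConstant.one_sub_le_measureReal_spectralNormOf_losMatrix {K : ℝ} (hK : IsLosConstant K)
    {M : ℕ} (hM : 16 ≤ M) {d θ₁ θ₂ : ℝ} {o₁ o₂ : Plane} (hd : 2 * √M ≤ d) (hdist : dist o₁ o₂ = d)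
    {Ω : Type*} [MeasurableSpace Ω] {P : Measure Ω} [IsProbabilityMeasure P]
    {X Y : Fin M → Ω → Plane} (hX : iIndepFun X P) (hY : iIndepFun Y P)
    (hUX : ∀ j, pdf.IsUniform (X j) (tiltedSquare o₁ θ₁ √M) P volume)
    (hUY : ∀ k, pdf.IsUniform (Y k) (tiltedSquare o₂ θ₂ √M) P volume) (m : ℕ) :
    1 - 8 * M * (m.factorial : ℝ)⁻¹ ≤
      P.real {ω | spectralNormOf (losMatrix (fun j => X j ω) (fun k => Y k ω)) ^ 2 ≤
        512 * 25856 * 16 ^ 7 * K ^ 2 * (M * m ^ 2 * (1 + Real.log M) / d)} := by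
  have hM₁ : 1 ≤ M := by omega
  obtain ⟨α, hα₀, hα₁⟩ := exists_planeRotation_aligned o₁ o₂
  have hbad₁ := measureReal_not_occupancyLE_gridCell_le hM hX hUX α m
  have hbad₂ := measureReal_not_occupancyLE_gridCell_le hM hY hUY α m
  refine le_trans (by linarith) (one_sub_measureReal_add_le
    (A := {ω | ¬OccupancyLE Finset.univ (fun j => gridCell α (X j ω)) m})
    (B := {ω | ¬OccupancyLE Finset.univ (fun k => gridCell α (Y k ω)) m}) ?_)
  filter_upwards [ae_all_iff.2 fun j => ae_mem_of_isUniform_tiltedSquare hM₁ (hUX j),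
    ae_all_iff.2 fun k => ae_mem_of_isUniform_tiltedSquare hM₁ (hUY k)] with ω hx hy hxm hym
  exact hK.spectralNormOf_losMatrix_sq_le hM hd (hα₀.trans hdist) hα₁ hx hy (not_not.1 hxm)
    (not_not.1 hym)

theorem mainTheorem4_general {ε : ℝ} (hε : 0 < ε) : ∃ c : ℝ, 0 < c ∧
    ∀ p : ℝ, 0 < p → ∃ C : ℝ, 0 < C ∧
      ∀ (M : ℕ) (d : ℝ), 1 ≤ M → 2 * √M ≤ d →
      ∀ (o₁ o₂ : Plane) (θ₁ θ₂ : ℝ), dist o₁ o₂ = d →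
      ∀ (Ω : Type*) [MeasurableSpace Ω] (P : Measure Ω) [IsProbabilityMeasure P]
        (X Y : Fin M → Ω → Plane), iIndepFun X P → iIndepFun Y P →
        (∀ j, pdf.IsUniform (X j) (tiltedSquare o₁ θ₁ √M) P volume) →
        (∀ k, pdf.IsUniform (Y k) (tiltedSquare o₂ θ₂ √M) P volume) →
        1 - C * (M : ℝ) ^ (-p) ≤
          P.real {ω | spectralNormOf (losMatrix (fun j => X j ω) (fun k => Y k ω)) ^ 2 ≤
            c * ((M : ℝ) ^ (1 + ε) / d)} := by
  obtain ⟨K, hK⟩ := exists_isLosConstant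
  have hK₀ : 0 < K := hK.pos
  refine ⟨512 * 25856 * 16 ^ 7 * K ^ 2 * (4 * (1 + 2 / ε)), by positivity, fun p hp => ?_⟩
  obtain ⟨C, hC, hfac⟩ := exists_mul_inv_factorial_ceil_rpow_le (η := ε / 4) (by positivity) p
  refine ⟨16 ^ p + 8 * C, by positivity, ?_⟩
  intro M d hM hd o₁ o₂ θ₁ θ₂ hdist Ω _ P _ X Y hX hY hUX hUY
  have hM₁ : (1 : ℝ) ≤ M := by exact_mod_cast hM
  rw [add_mul]
  rcases lt_or_ge M 16 with hsmall | hlarge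
  · have hone : 1 ≤ (16 : ℝ) ^ p * (M : ℝ) ^ (-p) :=
      one_le_rpow_mul_rpow_neg (by linarith) (by exact_mod_cast hsmall.le) hp.le
    have hfail : 0 ≤ 8 * C * (M : ℝ) ^ (-p) := by positivity
    exact le_trans (by linarith) measureReal_nonneg
  · have hsixteen : 0 ≤ (16 : ℝ) ^ p * (M : ℝ) ^ (-p) := by positivity
    have hbound : 512 * 25856 * 16 ^ 7 * K ^ 2 *
        (M * ⌈(M : ℝ) ^ (ε / 4)⌉₊ ^ 2 * (1 + Real.log M) / d) ≤
        512 * 25856 * 16 ^ 7 * K ^ 2 * (4 * (1 + 2 / ε)) * ((M : ℝ) ^ (1 + ε) / d) := by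
      rw [mul_assoc _ (4 * _)]
      gcongr
      exact mul_ceil_rpow_sq_mul_one_add_log_div_le hε hM₁ (hdist ▸ dist_nonneg)
    have hprob := hK.one_sub_le_measureReal_spectralNormOf_losMatrix hlarge hd hdist hX hY hUX hUY
      ⌈(M : ℝ) ^ (ε / 4)⌉₊
    refine le_trans ?_ (hprob.trans (measureReal_mono fun ω hω => ?_))
    · linarith [hfac M hM₁]
    · exact (Set.mem_ofPred.1 hω).trans hbound

end MainTheorem

end

theorem mainTheorem4 :
    ∀ ε : ℝ, 0 < ε → ∃ c : ℝ, 0 < c ∧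
      ∀ p : ℝ, 0 < p → ∃ C : ℝ, 0 < C ∧
        ∀ (M : ℕ) (d : ℝ), 1 ≤ M → 2 * Real.sqrt M ≤ d → d ≤ M →
        ∀ (o₁ o₂ : Plane) (θ₁ θ₂ : ℝ), dist o₁ o₂ = d →
        ∀ (Ω : Type*) [MeasurableSpace Ω] (P : Measure Ω) [IsProbabilityMeasure P]
          (X Y : Fin M → Ω → Plane), IsUniformClusterPair P M o₁ o₂ θ₁ θ₂ X Y →
          1 - C * (M : ℝ) ^ (-p) ≤
            P.real {ω | spectralNormOf (losMatrix (fun j => X j ω) (fun k => Y k ω)) ^ 2 ≤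
              c * ((M : ℝ) ^ (1 + ε) / d)} := by
  intro ε hε
  obtain ⟨c, hc, hbound⟩ := mainTheorem4_general hε
  exact ⟨c, hc, fun p hp => (hbound p hp).imp fun C ⟨hC, hprob⟩ => ⟨hC,
    fun M d hM hd _ o₁ o₂ θ₁ θ₂ hdist Ω _ P _ X Y hXY => hprob M d hM hd o₁ o₂ θ₁ θ₂ hdist Ω P X Y
      (hXY.indep.precomp (g := Sum.inl) Sum.inl_injective)
      (hXY.indep.precomp (g := Sum.inr) Sum.inr_injective) hXY.uniform_fst hXY.uniform_snd⟩⟩
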